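/- **Setting.** Let $\Omega\subset\mathbb R^d$ be nonempty, closed and convex with $\|x-y\|\le D$ for all $x,y\in\Omega$, where $D>0$. Let $f_1,\dots,f_T$ be differentiable loss functions on $\Omega$ with $\|\nabla f_t(w)\|\le G$ for all $w\in\Omega$ and $t\in[T]=\{1,\dots,T\}$, where $G>0$. Throughout, $\log$ is the natural logarithm. **The algorithm UMA** (it knows $D,G$ and $\Omega$, but neither $T$ nor any parameter of the losses, and it sees only $g_t=\nabla f_t(w_t)$, where $w_t$ is the point it submits in round $t$). Let $\mathcal I$ be the set of intervals $I=[i2^k,(i+1)2^k-1]$, $i\ge1$, $k\ge 0$, and let $\mathcal S(n)=\{2^{-i}/(5DG): i=0,1,\dots,\lceil\frac12\log_2 n\rceil\}$. For each $I\in\mathcal I$ and $\eta\in\mathcal S(|I|)$ there are two experts, which are active exactly in the rounds $t\in I$, start from arbitrary points of $\Omega$ and have cumulative loss $L=\hat L=0$ before their first round. Their surrogate losses in round $t$ are $$\ell_t^\eta(v)=-\eta\langle g_t,w_t-v\rangle+\eta^2\langle g_t,w_t-v\rangle^2,\qquad \hat\ell_t^\eta(v)=-\eta\langle g_t,w_t-v\rangle+\eta^2\|g_t\|^2\|w_t-v\|^2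 .$$ 1. The first expert runs online Newton step: with $\beta_0=25/56$ and $\Sigma=\frac1{\beta_0^2D^2}\mathrm{Id}$ initially, in each active round it replaces $\Sigma$ by $\Sigma+hh^\top$ and then its point $v$ by $\operatorname{argmin}_{u\in\Omega}(u-x)^\top\Sigma(u-x)$ with $x=v-\frac1{\beta_0}\Sigma^{-1}h$, where $h=\nabla\ell_t^\eta(v)$. 2. The second expert runs adaptive online gradient descent: in each active round it replaces its point $\hat v$ by the Euclidean projection onto $\Omega$ of $\hat v-\frac1{\alpha_t}\nabla\hat\ell^\eta_t(\hat v)$, where $\alpha_t=2\eta^2G^2+2\eta^2\sum_i\|g_i\|^2$ and $i$ runs over the rounds of $I$ up to $t$. In each active round $L$ grows by $\ell_t^\eta(v)$ and $\hat L$ by $\hat\ell_t^\eta(\hat v)$, evaluated at the points predicted for that round. In round $t$ UMA submits the weighted average $w_t$ of the current points of all active experts, with weights $\eta e^{-L}$ for the first kind and $\eta e^{-\hat L}$ for the second kind. **Theorem.** Put $$a(p,q)=2\log_2(2q)+5d\log(q-p+2)+5,\quad \hat a(p,q)=1+2\log_2(2q)+\log(q-p+2),\quad b(p,q)=2\lceil\log_2(q-p+2)\rceil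 .$$ There is an absolute constant $C>0$ such that, for all data as above, all $1\le p\le q\le T$ and all $w\in\Omega$, writing $a,\hat a,b$ for the values at $(p,q)$ and $\sum$ for $\sum_{t=p}^q$, the following hold. (i) $\sum\langle\nabla f_t(w_t),w_t-w\rangle\le 10DG\,ab+3\sqrt{ab}\,\sqrt{\sum\langle\nabla f_t(w_t),w_t-w\rangle^2}$. (ii) If $\alpha>0$ and $\exp(-\alpha f_t)$ is concave on $\Omega$ for all $t\in[p,q]$, then with $\beta=\frac12\min\{\frac1{4GD},\alpha\}$ $$\sum f_t(w_t)-\sum f_t(w)\le\Bigl(10DG+\frac9{2\beta}\Bigr)ab ,$$ and the left side is also at most $C(1+DG\alpha)\,\frac{d\,\log(q+1)\log(q-p+2)}{\alpha}$. (iii) $\sum\langle\nabla f_t(w_t),w_t-w\rangle\le 10DG\,\hat ab+3G\sqrt{\hat ab}\,\sqrt{\sum\|w_t-w\|^2}$. (iv) $\sum\langle\nabla f_t(w_t),w_t-w\rangle\le 10DG\,\hat ab+21DG\sqrt{\hat a\,(q-p+1)}$. (v) If $\lambda>0$ and $f_t(y)\ge f_t(x)+\langle\nabla f_t(x),y-x\rangle+\frac\lambda2\|y-x\|^2$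 for all $x,y\in\Omega$ and $t\in[p,q]$, then $$\sum f_t(w_t)-\sum f_t(w)\le\Bigl(10DG+\frac{9G^2}{2\lambda}\Bigr)\hat ab ,$$ and the left side is also at most $C(G^2+DG\lambda)\,\frac{\log(q+1)\log(q-p+2)}{\lambda}$. For $1\le\tau\le T$ let $$\mathrm{SA}(T,\tau)=\max_{[p,p+\tau-1]\subseteq[T]}\Bigl(\sum_{t=p}^{p+\tau-1}f_t(w_t)-\min_{w\in\Omega}\sum_{t=p}^{p+\tau-1}f_t(w)\Bigr).$$ (vi) If all $f_t$, $t\in[T]$, are convex on $\Omega$, then $\mathrm{SA}(T,\tau)\le C\,DG\sqrt{\tau\log(T+1)}$. If all are $\alpha$-exp-concave as in (ii), then $\mathrm{SA}(T,\tau)\le C(1+DG\alpha)\,\frac d\alpha\log(\tau+1)\log(T+1)$. If all are $\lambda$-strongly convex as in (v), then $\mathrm{SA}(T,\tau)\le C(G^2+DG\lambda)\,\frac1\lambda\log(\tau+1)\log(T+1)$. Thus, for fixed $D,G$ and for $\alpha$, $\lambda$ bounded above, these rates are $O(\frac d\alpha\log q\log(q-p))$, $O(\frac1\lambda\log q\log(q-p))$,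 and, for the strongly adaptive regret, $O(\sqrt{\tau\log T})$, $O(\frac d\alpha\log\tau\log T)$ and $O(\frac1\lambda\log\tau\log T)$. -/

import Mathlib

open scoped BigOperators

namespace UMA

noncomputable section

/-- The ambient space `ℝ^d` with its Euclidean norm. -/
abbrev Vec (d : ℕ) : Type := EuclideanSpace ℝ (Fin d)

/-! ### Geometric covering intervals and learning rates -/

/-- The geometric covering intervals `[i * 2^k, (i+1) * 2^k - 1]` with `k ≥ 0` and `i ≥ 1`; the interval
`[r, s]` of rounds is represented by the pair `(r, s)`. -/
def gcIntervals : Set (ℕ × ℕ) :=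
  {I | ∃ k i : ℕ, 1 ≤ i ∧ I = (i * 2 ^ k, (i + 1) * 2 ^ k - 1)}

open scoped Classical in
/-- The geometric covering intervals that contain round `t`, that is, those whose experts are active in
round `t`: they have been created in round `I.1 ≤ t` and are removed after round `I.2 ≥ t`. -/
def activeIntervals (t : ℕ) : Finset (ℕ × ℕ) :=
  ((Finset.range (t + 1)) ×ˢ (Finset.range (2 * t))).filter
    fun I => I ∈ gcIntervals ∧ I.1 ≤ t ∧ t ≤ I.2

theorem mem_activeIntervals (t : ℕ) (I : ℕ × ℕ) :
    I ∈ activeIntervals t ↔ I ∈ gcIntervals ∧ I.1 ≤ t ∧ t ≤ I.2 := by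
  unfold activeIntervals
  simp only [Finset.mem_filter, Finset.mem_product, Finset.mem_range]
  refine ⟨fun h => h.2, fun h => ⟨?_, h⟩⟩
  obtain ⟨⟨k, i, hi, rfl⟩, h1, h2⟩ := h
  have hk : 1 ≤ 2 ^ k := Nat.one_le_two_pow
  have h3 : 2 ^ k ≤ i * 2 ^ k := Nat.le_mul_of_pos_left _ hi
  simp only [add_mul, one_mul] at *
  omega

/-- The number of rounds of the interval `[r, s]`. -/
def intervalLength (I : ℕ × ℕ) : ℕ := I.2 + 1 - I.1

/-- The grid of learning rates `2^{-i} / (5 D G)`, `i = 0, …, ⌈(1/2) log₂ n⌉`. -/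
def learningRates (D G : ℝ) (n : ℕ) : Finset ℝ :=
  (Finset.range (⌈(1 / 2 : ℝ) * Real.logb 2 n⌉₊ + 1)).image
    fun i : ℕ => (2 : ℝ) ^ (-(i : ℤ)) / (5 * D * G)

/-! ### Surrogate losses

Below `γ` is the gradient of the current loss at the submitted point `w`. -/

/-- `ℓ^η(v) = -η ⟨γ, w - v⟩ + η² ⟨γ, w - v⟩²`. -/
def surrogate {d : ℕ} (η : ℝ) (γ w v : Vec d) : ℝ :=
  -η * inner ℝ γ (w - v) + η ^ 2 * (inner ℝ γ (w - v)) ^ 2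

/-- The gradient of `surrogate η γ w` at `v`. -/
def surrogateGrad {d : ℕ} (η : ℝ) (γ w v : Vec d) : Vec d :=
  η • γ + (2 * η ^ 2 * inner ℝ γ (v - w)) • γ

/-- `ℓ̂^η(v) = -η ⟨γ, w - v⟩ + η² ‖γ‖² ‖w - v‖²`. -/
def surrogateHat {d : ℕ} (η : ℝ) (γ w v : Vec d) : ℝ :=
  -η * inner ℝ γ (w - v) + η ^ 2 * ‖γ‖ ^ 2 * ‖w - v‖ ^ 2

/-- The gradient of `surrogateHat η γ w` at `v`. -/
def surrogateHatGrad {d : ℕ} (η : ℝ) (γ w v : Vec d) : Vec d :=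
  η • γ + (2 * η ^ 2 * ‖γ‖ ^ 2) • (v - w)

/-! ### Projections -/

/-- A minimizer of `φ` over `Ω` (an arbitrary point if there is none). -/
def argminOn {d : ℕ} (φ : Vec d → ℝ) (Ω : Set (Vec d)) : Vec d :=
  Classical.epsilon fun w => w ∈ Ω ∧ IsMinOn φ Ω w

theorem argminOn_spec {d : ℕ} {φ : Vec d → ℝ} {Ω : Set (Vec d)} (hc : IsCompact Ω)
    (hn : Ω.Nonempty) (hφ : ContinuousOn φ Ω) :
    argminOn φ Ω ∈ Ω ∧ IsMinOn φ Ω (argminOn φ Ω) :=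
  Classical.epsilon_spec (hc.exists_isMinOn hn hφ)

/-- The generalized projection `argmin_{w ∈ Ω} (w - x)ᵀ A (w - x)`. -/
def genProj {d : ℕ} (Ω : Set (Vec d)) (A : Matrix (Fin d) (Fin d) ℝ) (x : Vec d) : Vec d :=
  argminOn (fun w => (w - x).ofLp ⬝ᵥ A.mulVec (w - x).ofLp) Ω

/-- The Euclidean projection `argmin_{w ∈ Ω} ‖w - x‖`. -/
def proj {d : ℕ} (Ω : Set (Vec d)) (x : Vec d) : Vec d :=
  argminOn (fun w => ‖w - x‖) Ω

/-! ### Online Newton step experts -/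

/-- The state of an online Newton step expert between two rounds. -/
structure OnsState (d : ℕ) where
  /-- the next prediction -/
  point : Vec d
  /-- the matrix `Σ` -/
  sigma : Matrix (Fin d) (Fin d) ℝ
  /-- the cumulative surrogate loss -/
  loss : ℝ

/-- `β = (1/2) min (1 / (4 D · 7/(25 D)), 1) = 25/56`. -/
def onsBeta : ℝ := 25 / 56

/-- A newly created online Newton step expert that starts from the point `x`. -/
def onsInit {d : ℕ} (D : ℝ) (x : Vec d) : OnsState d where
  point := x
  sigma := (1 / (onsBeta ^ 2 * D ^ 2)) • (1 : Matrix (Fin d) (Fin d) ℝ)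
  loss := 0

/-- One round of an online Newton step expert with learning rate `η`, after the learner has submitted
`w` and has observed the gradient `γ`. -/
def onsStep {d : ℕ} (Ω : Set (Vec d)) (η : ℝ) (γ w : Vec d) (S : OnsState d) : OnsState d :=
  let v := surrogateGrad η γ w S.point
  let A := S.sigma + Matrix.vecMulVec v.ofLp v.ofLp
  { point := genProj Ω A (S.point - (1 / onsBeta) • WithLp.toLp 2 (A⁻¹.mulVec v.ofLp))
    sigma := A
    loss := S.loss + surrogate η γ w S.point }

/-! ### Adaptive online gradient descent experts -/

/-- The state of an adaptive online gradient descent expert between two rounds. -/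
structure AogdState (d : ℕ) where
  /-- the next prediction -/
  point : Vec d
  /-- the sum of the squared norms of the gradients observed since the expert was created -/
  gradSq : ℝ
  /-- the cumulative surrogate loss -/
  loss : ℝ

/-- A newly created adaptive online gradient descent expert that starts from the point `x`. -/
def aogdInit {d : ℕ} (x : Vec d) : AogdState d where
  point := x
  gradSq := 0
  loss := 0

/-- One round of an adaptive online gradient descent expert with learning rate `η`, after the learner
has submitted `w` and has observed the gradient `γ`. -/
def aogdStep {d : ℕ} (Ω : Set (Vec d)) (G η : ℝ) (γ w : Vec d) (S : AogdState d) : AogdState d :=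
  let v := surrogateHatGrad η γ w S.point
  let a : ℝ := 2 * η ^ 2 * G ^ 2 + 2 * η ^ 2 * (S.gradSq + ‖γ‖ ^ 2)
  { point := proj Ω (S.point - (1 / a) • v)
    gradSq := S.gradSq + (‖γ‖ ^ 2 : ℝ)
    loss := S.loss + surrogateHat η γ w S.point }

/-! ### The meta-algorithm -/

/-- The states of all experts; an expert is labelled by its interval and its learning rate. -/
structure State (d : ℕ) where
  ons : ℕ × ℕ → ℝ → OnsState d
  aogd : ℕ × ℕ → ℝ → AogdState d

/-- All experts before their first round, started from the points `x₀ I η` (online Newton step) and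
`y₀ I η` (adaptive online gradient descent). -/
def initState {d : ℕ} (D : ℝ) (x₀ y₀ : ℕ × ℕ → ℝ → Vec d) : State d where
  ons := fun I η => onsInit D (x₀ I η)
  aogd := fun I η => aogdInit (y₀ I η)

/-- The point submitted in round `t`: the tilted exponentially weighted average of the predictions of
the active experts. -/
def combine {d : ℕ} (D G : ℝ) (t : ℕ) (S : State d) : Vec d :=
  (∑ I ∈ activeIntervals t, ∑ η ∈ learningRates D G (intervalLength I),
      (Real.exp (-(S.ons I η).loss) * η + Real.exp (-(S.aogd I η).loss) * η))⁻¹ •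
    ∑ I ∈ activeIntervals t, ∑ η ∈ learningRates D G (intervalLength I),
      ((Real.exp (-(S.ons I η).loss) * η) • (S.ons I η).point
        + (Real.exp (-(S.aogd I η).loss) * η) • (S.aogd I η).point)

/-- Round `t`: with `w` the submitted point and `γ` the observed gradient, every expert whose interval
contains `t` is updated. All others keep their state. -/
def stepState {d : ℕ} (Ω : Set (Vec d)) (G : ℝ) (t : ℕ) (γ w : Vec d) (S : State d) : State d where
  ons := fun I η => if I.1 ≤ t ∧ t ≤ I.2 then onsStep Ω η γ w (S.ons I η) else S.ons I η
  aogd := fun I η => if I.1 ≤ t ∧ t ≤ I.2 then aogdStep Ω G η γ w (S.aogd I η) else S.aogd I η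

/-- The state at the beginning of round `t`. The rounds are `1, 2, 3, …`; no geometric covering interval
contains `0`, so that "round `0`" changes no expert. Of the losses the algorithm sees only the gradient
`g t w` at the point `w` that it submits in round `t`. -/
def state {d : ℕ} (Ω : Set (Vec d)) (D G : ℝ) (g : ℕ → Vec d → Vec d)
    (x₀ y₀ : ℕ × ℕ → ℝ → Vec d) : ℕ → State d
  | 0 => initState D x₀ y₀
  | t + 1 =>
    let S := state Ω D G g x₀ y₀ t
    let w := combine D G t S
    stepState Ω G t (g t w) w S

/-- The point that the algorithm submits in round `t`. -/
def play {d : ℕ} (Ω : Set (Vec d)) (D G : ℝ) (g : ℕ → Vec d → Vec d)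
    (x₀ y₀ : ℕ × ℕ → ℝ → Vec d) (t : ℕ) : Vec d :=
  combine D G t (state Ω D G g x₀ y₀ t)

/-! ### Classes of functions, regret, and the quantities in the bounds -/

/-- `λ`-strong convexity on `Ω` of a function `f` with gradient `g`. -/
def StronglyConvexOn {d : ℕ} (Ω : Set (Vec d)) (lam : ℝ) (f : Vec d → ℝ) (g : Vec d → Vec d) : Prop :=
  ∀ x ∈ Ω, ∀ y ∈ Ω, f x + inner ℝ (g x) (y - x) + lam / 2 * ‖y - x‖ ^ 2 ≤ f y

/-- `α`-exp-concavity on `Ω`. -/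
def ExpConcaveOn {d : ℕ} (Ω : Set (Vec d)) (α : ℝ) (f : Vec d → ℝ) : Prop :=
  ConcaveOn ℝ Ω fun w => Real.exp (-α * f w)

/-- The static regret of the points `w` over the rounds `p, …, q`. -/
def staticRegret {d : ℕ} (Ω : Set (Vec d)) (f : ℕ → Vec d → ℝ) (w : ℕ → Vec d) (p q : ℕ) : ℝ :=
  ∑ t ∈ Finset.Icc p q, f t (w t) - sInf ((fun u => ∑ t ∈ Finset.Icc p q, f t u) '' Ω)

/-- The strongly adaptive regret: the largest static regret over the intervals `[p, p + τ - 1]` of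
length `τ` inside `{1, …, T}`. -/
def saRegret {d : ℕ} (Ω : Set (Vec d)) (f : ℕ → Vec d → ℝ) (w : ℕ → Vec d) (T τ : ℕ) : ℝ :=
  sSup ((fun p => staticRegret Ω f w p (p + τ - 1)) '' {p | 1 ≤ p ∧ p + τ - 1 ≤ T})

/-- `a(p,q) = 2 log₂(2q) + 5 d log(q-p+2) + 5`. -/
def aFun (d p q : ℕ) : ℝ :=
  2 * Real.logb 2 (2 * q) + 5 * d * Real.log ((q : ℝ) - p + 2) + 5

/-- `â(p,q) = 1 + 2 log₂(2q) + log(q-p+2)`. -/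
def aHat (p q : ℕ) : ℝ :=
  1 + 2 * Real.logb 2 (2 * q) + Real.log ((q : ℝ) - p + 2)

/-- `b(p,q) = 2 ⌈log₂(q-p+2)⌉`. -/
def bFun (p q : ℕ) : ℝ :=
  2 * (⌈Real.logb 2 ((q : ℝ) - p + 2)⌉ : ℝ)

end

end UMA

/-! Fix a covering interval `I` inside `[p, q]` and a rate `η` of its grid. The surrogate loss of
the submitted point is zero, so the cumulative loss `L` of an expert on `I` measures it directly
against the learner. Two facts about `L` are combined.

From below (`Admissible.loss_ge`): all experts that start by round `q` are counted from the outset,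
including those still asleep, with weight `e^{-L}`. Since `exp (y - y²) ≤ 1 + y` for small `y`, one
round multiplies an active weight by at most `1 + η⟨γ, w - v⟩`. The submitted point is the
barycenter for the weights `η e^{-L}`, so the linear terms cancel and the potential never grows. It
starts at no more than `2q²`, hence `L ≥ -2 log₂(2q)`.

From above (`Admissible.ons_regret`, `Admissible.aogd_regret`): `L` exceeds the surrogate loss of a
comparator `u` only logarithmically. For Newton steps the surplus telescopes in log-determinants,
for gradient descent in logarithms of the accumulated squared gradients.

Together they give `η R ≤ A + η² V` for the linearized regret `R` on `I`, where `V` is the sum of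
`⟨γ, w - u⟩²` or of `G²‖w - u‖²`. Division by `η` and the best rate of the grid yield `R ≤ 10 D G A
+ 3 √(A V)` (`tuned_bound`).

An arbitrary `[p, q]` splits into at most `b` covering intervals (`exists_cover`); Cauchy–Schwarz
adds up the square roots. For the worst-case bound the lengths of the pieces are geometric, so their
square roots sum to `O(√(q - p + 1))` with no factor `√b`. Exp-concavity and strong convexity supply
a negative multiple of `V` that absorbs the square root. In the convex adaptive bound the
lower-order term disappears because short pieces are estimated trivially
(`Admissible.sum_inner_le_sqrt`). -/

namespace UMA

/-! ### Partition of an interval into dyadic pieces -/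

/-- The intervals of the list `P` are geometric covering intervals that partition `{x, …, y - 1}`. -/
structure IsCover (P : List (ℕ × ℕ)) (x y : ℕ) : Prop where
  mem : ∀ I ∈ P, I ∈ gcIntervals ∧ x ≤ I.1 ∧ I.1 ≤ I.2 ∧ I.2 < y
  sum_eq : ∀ h : ℕ → ℝ,
    (P.map fun I => ∑ t ∈ Finset.Icc I.1 I.2, h t).sum = ∑ t ∈ Finset.Ico x y, h t

/-- The sum of the square roots of the lengths. -/
noncomputable def sqrtLength (P : List (ℕ × ℕ)) : ℝ :=
  (P.map fun I => √(intervalLength I : ℝ)).sum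

lemma IsCover.append {P Q : List (ℕ × ℕ)} {x y z : ℕ} (hP : IsCover P x y) (hQ : IsCover Q y z)
    (hxy : x ≤ y) (hyz : y ≤ z) : IsCover (P ++ Q) x z where
  mem I hI := by
    rcases List.mem_append.1 hI with h | h
    · obtain ⟨h1, h2, h3, h4⟩ := hP.mem I h
      exact ⟨h1, h2, h3, by omega⟩
    · obtain ⟨h1, h2, h3, h4⟩ := hQ.mem I h
      exact ⟨h1, by omega, h3, h4⟩
  sum_eq h := by
    rw [List.map_append, List.sum_append, hP.sum_eq, hQ.sum_eq,
      Finset.sum_Ico_consecutive _ hxy hyz]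

lemma isCover_nil (x : ℕ) : IsCover [] x x where
  mem I hI := by simp at hI
  sum_eq h := by simp

lemma sqrtLength_append (P Q : List (ℕ × ℕ)) :
    sqrtLength (P ++ Q) = sqrtLength P + sqrtLength Q := by
  simp [sqrtLength]

lemma exists_cover_le_one (k : ℕ) {a a' : ℕ} (ha : 1 ≤ a) (h1 : a ≤ a') (h2 : a' ≤ a + 1) :
    ∃ P, IsCover P (a * 2 ^ k) (a' * 2 ^ k) ∧ P.length ≤ 1 ∧ sqrtLength P ≤ √2 ^ k := by
  obtain rfl | rfl : a' = a ∨ a' = a + 1 := by omega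
  · exact ⟨[], isCover_nil _, by simp, by simp [sqrtLength]⟩
  · have hk : 1 ≤ 2 ^ k := Nat.one_le_two_pow
    have hlt : a * 2 ^ k + 2 ^ k = (a + 1) * 2 ^ k := by ring
    refine ⟨[(a * 2 ^ k, (a + 1) * 2 ^ k - 1)], ⟨?_, ?_⟩, by simp, ?_⟩
    · intro I hI
      obtain rfl := List.mem_singleton.1 hI
      exact ⟨⟨k, a, ha, rfl⟩, le_rfl, by simp only; omega, by simp only; omega⟩
    · intro h
      simp only [List.map_cons, List.map_nil, List.sum_cons, List.sum_nil, add_zero]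
      congr 1
      ext t
      simp only [Finset.mem_Icc, Finset.mem_Ico]
      omega
    · have : intervalLength (a * 2 ^ k, (a + 1) * 2 ^ k - 1) = 2 ^ k := by
        simp only [intervalLength]; omega
      have h2 : √((2 : ℝ) ^ k) = √2 ^ k := by
        rw [Real.sqrt_eq_iff_mul_self_eq (by positivity) (by positivity), ← mul_pow,
          Real.mul_self_sqrt (by norm_num)]
      simp [sqrtLength, this, h2]

/-- At scale `2^k`, cut off one block at each end whose index is odd; what remains has even
endpoints and lives at scale `2^(k+1)` with half as many blocks. Each level thus costs at most two
blocks, and the square roots of their lengths grow by the factor `√2` per level. -/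
lemma exists_cover_levels (m : ℕ) : ∀ k a b : ℕ, 1 ≤ a → a ≤ b → b < a + 2 ^ m →
    ∃ P, IsCover P (a * 2 ^ k) (b * 2 ^ k) ∧ P.length ≤ 2 * m ∧
      sqrtLength P ≤ 2 * (∑ j ∈ Finset.range m, √2 ^ j) * √2 ^ k := by
  induction m with
  | zero =>
    intro k a b ha hab hb
    obtain rfl : b = a := by simp at hb; omega
    exact ⟨[], isCover_nil _, by simp, by simp [sqrtLength]⟩
  | succ m ih =>
    intro k a b ha hab hb
    -- The empty range must be separated: for odd `a = b`, rounding `a` up and `b` down would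
    -- reverse the endpoints.
    rcases hab.eq_or_lt with rfl | hlt
    · exact ⟨[], isCover_nil _, by simp, by simp only [sqrtLength, List.map_nil, List.sum_nil]; positivity⟩
    · have hpow : 2 ^ (m + 1) = 2 * 2 ^ m := by ring
      have e1 : ∀ x : ℕ, x * 2 ^ (k + 1) = 2 * x * 2 ^ k := fun x => by ring
      obtain ⟨P, hP, lP, sP⟩ := exists_cover_le_one k (a := a) (a' := 2 * ((a + 1) / 2)) ha
        (by omega) (by omega)
      obtain ⟨Q, hQ, lQ, sQ⟩ := ih (k + 1) ((a + 1) / 2) (b / 2) (by omega) (by omega) (by omega)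
      obtain ⟨R, hR, lR, sR⟩ := exists_cover_le_one k (a := 2 * (b / 2)) (a' := b)
        (by omega) (by omega) (by omega)
      rw [e1, e1] at hQ
      refine ⟨P ++ Q ++ R, (hP.append hQ ?_ ?_).append hR ?_ ?_, ?_, ?_⟩
      iterate 4 exact Nat.mul_le_mul_right _ (by omega)
      · simp only [List.length_append]; omega
      · rw [sqrtLength_append, sqrtLength_append]
        have : 2 * (∑ j ∈ Finset.range (m + 1), √2 ^ j) * √2 ^ k
            = 2 * (∑ j ∈ Finset.range m, √2 ^ j) * √2 ^ (k + 1) + 2 * √2 ^ k := by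
          rw [Finset.sum_range_succ', pow_zero]
          simp only [pow_succ, ← Finset.sum_mul]
          ring
        linarith

/-- Every `[p, q]` is the disjoint union of few geometric covering intervals, whose lengths grow and then
decrease geometrically. -/
lemma exists_cover {p q : ℕ} (hp : 1 ≤ p) (hpq : p ≤ q) :
    ∃ P, IsCover P p (q + 1) ∧ (P.length : ℝ) ≤ bFun p q ∧
      sqrtLength P ≤ 7 * √((q : ℝ) - p + 1) := by
  set n := q + 1 - p with hn
  have hn1 : 1 ≤ n := by omega
  have hnr : (n : ℝ) = (q : ℝ) - p + 1 := by
    rw [hn, Nat.cast_sub (by omega)]; push_cast; ring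
  set l := Nat.log 2 n with hl
  have hl1 : 2 ^ l ≤ n := Nat.pow_log_le_self 2 (by omega)
  have hl2 : n < 2 ^ (l + 1) := Nat.lt_pow_succ_log_self (by norm_num) n
  obtain ⟨P, hP, lP, sP⟩ := exists_cover_levels (l + 1) 0 p (q + 1) hp (by omega) (by omega)
  simp only [pow_zero, mul_one] at hP sP
  have hl1' : (2 : ℝ) ^ l ≤ n := by exact_mod_cast hl1
  refine ⟨P, hP, ?_, ?_⟩
  -- `2^l ≤ n < n + 1` gives `l < log₂(n + 1)` strictly, so the ceiling gains the missing unit; this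
  -- is why `b` contains `q - p + 2`.
  · have h1 : ((l : ℤ) + 1) ≤ ⌈Real.logb 2 ((q : ℝ) - p + 2)⌉ := by
      rw [Int.add_one_le_iff, Int.lt_ceil]
      rw [Real.lt_logb_iff_rpow_lt (by norm_num) (by linarith [show (1:ℝ) ≤ n by exact_mod_cast hn1])]
      push_cast
      rw [Real.rpow_natCast]
      linarith
    have h2 : ((l : ℝ) + 1) ≤ (⌈Real.logb 2 ((q : ℝ) - p + 2)⌉ : ℝ) := by exact_mod_cast h1
    have h3 : (P.length : ℝ) ≤ 2 * (l + 1) := by exact_mod_cast lP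
    unfold bFun
    linarith
  · refine sP.trans ?_
    rw [← hnr]
    -- The geometric sum is at most `2√2/(√2 - 1) · √2^l`, and the factor is at most `7` exactly
    -- when `√2 ≥ 7/5`.
    have h14 : (1.4 : ℝ) ≤ √2 := Real.le_sqrt_of_sq_le (by norm_num)
    have hg := geom_sum_mul (√2) (l + 1)
    have hs : √2 ^ l ≤ √(n : ℝ) := by
      apply Real.le_sqrt_of_sq_le
      rw [← pow_mul, mul_comm l 2, pow_mul, Real.sq_sqrt (by norm_num)]
      exact hl1'
    have hpos : 0 ≤ √2 ^ l := by positivity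
    refine le_trans ?_ (mul_le_mul_of_nonneg_left hs (by norm_num : (0:ℝ) ≤ 7))
    rw [pow_succ] at hg
    have h0 : 0 < √2 - 1 := by linarith
    rw [← mul_le_mul_iff_left₀ h0]
    nlinarith

/-! ### Choice of the learning rate -/

/-- Tuning of the learning rate over the grid. -/
lemma tuned_bound {D G A V R : ℝ} {n : ℕ} (hD : 0 < D) (hG : 0 < G) (hn : 1 ≤ n) (hA : 1 ≤ A)
    (hVn : V ≤ n * (D * G) ^ 2)
    (h : ∀ η ∈ learningRates D G n, R ≤ A / η + η * V) :
    R ≤ 10 * D * G * A + 3 * √(A * V) := by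
  have hDG : 0 < D * G := mul_pos hD hG
  -- The ideal rate `√(A/V)` is at least the largest rate `1/(5DG)` exactly in this case (for `V >
  -- 0`). The largest rate then makes both terms at most `5DGA`.
  by_cases hV : V ≤ 25 * (D * G) ^ 2 * A
  · have h0 := h ((2 : ℝ) ^ (-((0 : ℕ) : ℤ)) / (5 * D * G)) (Finset.mem_image.2 ⟨0, by simp, rfl⟩)
    have e1 : A / ((2 : ℝ) ^ (-((0 : ℕ) : ℤ)) / (5 * D * G)) = 5 * (D * G) * A := by
      simp; field_simp
    have e2 : (2 : ℝ) ^ (-((0 : ℕ) : ℤ)) / (5 * D * G) * V ≤ 5 * (D * G) * A := by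
      simp only [Nat.cast_zero, neg_zero, zpow_zero]
      rw [div_mul_eq_mul_div, one_mul, div_le_iff₀ (by positivity)]
      nlinarith
    have : 0 ≤ 3 * √(A * V) := by positivity
    linarith
  · push Not at hV
    have hV0 : 0 < V := lt_trans (by positivity) hV
    have hsA : 0 < √A := Real.sqrt_pos.2 (by linarith)
    have hsV : 0 < √V := Real.sqrt_pos.2 hV0
    have hA2 : √A ^ 2 = A := Real.sq_sqrt (by linarith)
    have hV2 : √V ^ 2 = V := Real.sq_sqrt hV0.le
    -- The ideal rate is `1/(5DGy)`. With `2^j ≤ y < 2^(j+1)`, the rate of index `j + 1` lies below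
    -- it by at most a factor two, so the two terms cost `2√(AV)` and `√(AV)`.
    set y := √V / (5 * (D * G) * √A) with hy
    have hy1 : 1 ≤ y := by
      rw [hy, one_le_div (by positivity)]
      apply Real.le_sqrt_of_sq_le
      rw [mul_pow, hA2]; nlinarith
    obtain ⟨j, hj1, hj2⟩ := exists_nat_pow_near hy1 (by norm_num : (1 : ℝ) < 2)
    have hη0 : (0 : ℝ) < 2 ^ (j + 1) := by positivity
    have hyV : 5 * (D * G) * √A * y = √V := by rw [hy]; field_simp
    -- The grid reaches far enough: `V ≤ n(DG)²` and `A ≥ 1` give `25y² ≤ n`, hence `(2^(j+1))² ≤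
    -- 4y² ≤ n`.
    have hjn : j + 1 ≤ ⌈(1 / 2 : ℝ) * Real.logb 2 n⌉₊ := by
      have h1 : ((2 : ℝ) ^ (j + 1)) ^ 2 ≤ n := by
        have hy2 : 25 * y ^ 2 ≤ n := by
          have : 25 * (D * G) ^ 2 * A * y ^ 2 ≤ n * (D * G) ^ 2 := by
            calc 25 * (D * G) ^ 2 * A * y ^ 2 = (5 * (D * G) * √A * y) ^ 2 := by
                  rw [mul_pow, mul_pow, mul_pow, hA2]; ring
              _ ≤ _ := by rw [hyV, hV2]; exact hVn
          have h3 : 25 * y ^ 2 * A ≤ n := by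
            rw [← mul_le_mul_iff_left₀ (pow_pos hDG 2)]; linarith
          nlinarith [sq_nonneg y]
        have : (2 : ℝ) ^ (j + 1) ≤ 2 * y := by rw [pow_succ]; linarith
        nlinarith
      have h2 : ((j + 1 : ℕ) : ℝ) ≤ (1 / 2 : ℝ) * Real.logb 2 n := by
        have : ((2 * (j + 1) : ℕ) : ℝ) ≤ Real.logb 2 n := by
          rw [Real.le_logb_iff_rpow_le (by norm_num) (by exact_mod_cast hn), Real.rpow_natCast,
            mul_comm, pow_mul]
          exact h1
        push_cast at this ⊢
        linarith
      exact_mod_cast h2.trans (Nat.le_ceil _)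
    have h0 := h ((2 : ℝ) ^ (-((j + 1 : ℕ) : ℤ)) / (5 * D * G))
      (Finset.mem_image.2 ⟨j + 1, Finset.mem_range.2 (by omega), rfl⟩)
    rw [zpow_neg, zpow_natCast] at h0
    have e1 : A / (((2 : ℝ) ^ (j + 1))⁻¹ / (5 * D * G)) ≤ 2 * (√A * √V) := by
      rw [div_div_eq_mul_div, div_inv_eq_mul]
      calc A * (5 * D * G) * 2 ^ (j + 1) ≤ A * (5 * D * G) * (2 * y) := by
            gcongr; rw [pow_succ]; linarith
        _ = 2 * (√A * (5 * (D * G) * √A * y)) := by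
            nth_rw 1 [← hA2]; ring
        _ = _ := by rw [hyV]
    have e2 : ((2 : ℝ) ^ (j + 1))⁻¹ / (5 * D * G) * V ≤ √A * √V := by
      rw [inv_eq_one_div, div_div, div_mul_eq_mul_div, one_mul, div_le_iff₀ (by positivity)]
      calc V = √V * √V := by nlinarith
        _ = √V * (5 * (D * G) * √A * y) := by rw [hyV]
        _ ≤ √V * (5 * (D * G) * √A * 2 ^ (j + 1)) := by gcongr
        _ = _ := by ring
    rw [Real.sqrt_mul (by linarith)]
    have : 0 ≤ 10 * D * G * A := by positivity
    linarith

end UMA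

namespace UMA
open Matrix

/-! ### Quadratic forms, projections and log-determinants -/

lemma dotProduct_mulVec_comm {n : Type*} [Fintype n] {A : Matrix n n ℝ} (hA : A.IsHermitian)
    (x y : n → ℝ) : x ⬝ᵥ A *ᵥ y = y ⬝ᵥ A *ᵥ x := by
  have hT : Aᵀ = A := by simpa using hA.eq
  rw [dotProduct_mulVec, dotProduct_comm, ← mulVec_transpose, hT]

lemma quadForm_add {n : Type*} [Fintype n] {A : Matrix n n ℝ} (hA : A.IsHermitian)
    (x y : n → ℝ) (c : ℝ) :
    (x + c • y) ⬝ᵥ A *ᵥ (x + c • y)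
      = x ⬝ᵥ A *ᵥ x + 2 * c * (y ⬝ᵥ A *ᵥ x) + c ^ 2 * (y ⬝ᵥ A *ᵥ y) := by
  simp only [mulVec_add, mulVec_smul, add_dotProduct, dotProduct_add, smul_dotProduct,
    dotProduct_smul, smul_eq_mul]
  rw [dotProduct_mulVec_comm hA x y]
  ring

/-- Two points of a convex set, one of which minimizes the quadratic form around `x`. -/
lemma quadForm_projection_le {d : ℕ} {Ω : Set (Vec d)} (hΩ : Convex ℝ Ω)
    {A : Matrix (Fin d) (Fin d) ℝ} (hA : A.PosSemidef) {x v u : Vec d} (hv : v ∈ Ω) (hu : u ∈ Ω)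
    (hmin : ∀ y ∈ Ω, (v - x).ofLp ⬝ᵥ A *ᵥ (v - x).ofLp ≤ (y - x).ofLp ⬝ᵥ A *ᵥ (y - x).ofLp) :
    (v - u).ofLp ⬝ᵥ A *ᵥ (v - u).ofLp ≤ (x - u).ofLp ⬝ᵥ A *ᵥ (x - u).ofLp := by
  have hH := hA.isHermitian
  set P := (u - v).ofLp ⬝ᵥ A *ᵥ (v - x).ofLp with hP
  set Q := (u - v).ofLp ⬝ᵥ A *ᵥ (u - v).ofLp with hQ
  have hpos : ∀ y : Fin d → ℝ, 0 ≤ y ⬝ᵥ A *ᵥ y := fun y => by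
    simpa using hA.dotProduct_mulVec_nonneg y
  have hQ0 : 0 ≤ Q := hpos _
  have key : ∀ c : ℝ, 0 ≤ c → c ≤ 1 → 0 ≤ 2 * c * P + c ^ 2 * Q := by
    intro c hc0 hc1
    have hy : v + c • (u - v) ∈ Ω := hΩ.add_smul_sub_mem hv hu ⟨hc0, hc1⟩
    have h1 := hmin _ hy
    have e : (v + c • (u - v) - x).ofLp = (v - x).ofLp + c • (u - v).ofLp := by
      ext i; simp; ring
    rw [e, quadForm_add hH] at h1
    linarith
  -- First-order optimality at `v` in the direction of `u`. Since `A` is only semidefinite, `Q` may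
  -- vanish; `-P/(Q - P)` replaces the minimizer `-P/Q` and always lies in `[0, 1]` when `P < 0`.
  have hP0 : 0 ≤ P := by
    by_contra hneg
    push Not at hneg
    have hd : 0 < Q - P := by linarith
    have h1 := key (-P / (Q - P)) (div_nonneg (by linarith) hd.le)
      ((div_le_one hd).2 (by linarith))
    have e : 2 * (-P / (Q - P)) * P + (-P / (Q - P)) ^ 2 * Q
        = (-P) / (Q - P) ^ 2 * (P * (Q - 2 * P)) := by
      field_simp; ring
    rw [e] at h1
    have h2 : 0 < -P / (Q - P) ^ 2 := div_pos (by linarith) (by positivity)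
    have h3 : P * (Q - 2 * P) < 0 := mul_neg_of_neg_of_pos hneg (by linarith)
    exact absurd h1 (not_le.2 (mul_neg_of_pos_of_neg h2 h3))
  have e2 : (x - u).ofLp = (-1 : ℝ) • ((v - x).ofLp + (1 : ℝ) • (u - v).ofLp) := by
    ext i; simp
  have e3 : (v - u).ofLp = (-1 : ℝ) • (u - v).ofLp := by
    ext i; simp
  rw [e2, e3]
  simp only [mulVec_smul, dotProduct_smul, smul_dotProduct, smul_eq_mul]
  rw [quadForm_add hH]
  have := hpos (v - x).ofLp
  linarith

lemma norm_sq_eq_dotProduct {d : ℕ} (x : Vec d) : ‖x‖ ^ 2 = x.ofLp ⬝ᵥ x.ofLp := by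
  rw [← real_inner_self_eq_norm_sq, EuclideanSpace.inner_eq_star_dotProduct]
  simp

lemma inner_eq_dotProduct {d : ℕ} (x y : Vec d) : inner ℝ x y = x.ofLp ⬝ᵥ y.ofLp := by
  rw [EuclideanSpace.inner_eq_star_dotProduct, dotProduct_comm]
  simp

lemma continuous_quadForm {d : ℕ} (A : Matrix (Fin d) (Fin d) ℝ) (x : Vec d) :
    Continuous fun w : Vec d => (w - x).ofLp ⬝ᵥ A *ᵥ (w - x).ofLp := by
  have h : Continuous fun w : Vec d => (w - x).ofLp :=
    (PiLp.continuous_ofLp 2 _).comp (continuous_id.sub continuous_const)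
  exact h.dotProduct (continuous_const.matrix_mulVec h)

lemma genProj_mem {d : ℕ} {Ω : Set (Vec d)} (hc : IsCompact Ω) (hn : Ω.Nonempty)
    (A : Matrix (Fin d) (Fin d) ℝ) (x : Vec d) : genProj Ω A x ∈ Ω :=
  (argminOn_spec hc hn (continuous_quadForm A x).continuousOn).1

lemma genProj_le {d : ℕ} {Ω : Set (Vec d)} (hc : IsCompact Ω) (hΩ : Convex ℝ Ω)
    {A : Matrix (Fin d) (Fin d) ℝ} (hA : A.PosSemidef) (x : Vec d) {u : Vec d} (hu : u ∈ Ω) :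
    (genProj Ω A x - u).ofLp ⬝ᵥ A *ᵥ (genProj Ω A x - u).ofLp
      ≤ (x - u).ofLp ⬝ᵥ A *ᵥ (x - u).ofLp := by
  have h := argminOn_spec hc ⟨u, hu⟩ (continuous_quadForm A x).continuousOn
  exact quadForm_projection_le hΩ hA h.1 hu fun y hy => h.2 hy

lemma proj_mem {d : ℕ} {Ω : Set (Vec d)} (hc : IsCompact Ω) (hn : Ω.Nonempty) (x : Vec d) :
    proj Ω x ∈ Ω :=
  (argminOn_spec hc hn (continuous_id.sub continuous_const).norm.continuousOn).1

lemma proj_le {d : ℕ} {Ω : Set (Vec d)} (hc : IsCompact Ω) (hΩ : Convex ℝ Ω) (x : Vec d)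
    {u : Vec d} (hu : u ∈ Ω) : ‖proj Ω x - u‖ ^ 2 ≤ ‖x - u‖ ^ 2 := by
  have h := argminOn_spec (φ := fun w => ‖w - x‖) hc ⟨u, hu⟩
    (continuous_id.sub continuous_const).norm.continuousOn
  have := quadForm_projection_le hΩ (A := 1) PosSemidef.one (x := x) h.1 hu fun y hy => by
    simp only [one_mulVec, ← norm_sq_eq_dotProduct]
    exact pow_le_pow_left₀ (norm_nonneg _) (h.2 hy) 2
  simp only [one_mulVec, ← norm_sq_eq_dotProduct] at this
  exact this

/-- The elliptical potential: a rank-one update in terms of log-determinants. -/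
lemma dotProduct_inv_mulVec_le {d : ℕ} {S : Matrix (Fin d) (Fin d) ℝ} (hS : S.PosDef)
    (h : Fin d → ℝ) :
    h ⬝ᵥ (S + vecMulVec h h)⁻¹ *ᵥ h
      ≤ Real.log (S + vecMulVec h h).det - Real.log S.det := by
  have hh : (vecMulVec h h).PosSemidef := by simpa using posSemidef_vecMulVec_self_star h
  set A := S + vecMulVec h h with hAdef
  have hA : A.PosDef := hS.add_posSemidef hh
  -- The matrix determinant lemma for `S = A - hhᵀ` reads `det S = det A · (1 - hᵀA⁻¹h)`; then `log
  -- (1 - x) ≤ -x`.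
  have hdet := det_add_replicateCol_mul_replicateRow (ι := Unit) hA.det_pos.ne'.isUnit h (-h)
  have e1 : A + replicateCol Unit h * replicateRow Unit (-h) = S := by
    rw [← vecMulVec_eq, vecMulVec_neg, hAdef]; abel
  have e2 : (1 + replicateRow Unit (-h) * A⁻¹ * replicateCol Unit h).det
      = 1 - h ⬝ᵥ A⁻¹ *ᵥ h := by
    simp [det_unique, Matrix.mul_assoc, Matrix.mul_apply, dotProduct, mulVec, sub_eq_add_neg]
  rw [e1, e2] at hdet
  have hpos : 0 < 1 - h ⬝ᵥ A⁻¹ *ᵥ h := by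
    have := hS.det_pos
    rw [hdet] at this
    exact pos_of_mul_pos_right this hA.det_pos.le
  rw [hdet, Real.log_mul hA.det_pos.ne' hpos.ne']
  have := Real.log_le_sub_one_of_pos hpos
  linarith

/-- AM–GM for the eigenvalues, in the tangent form `log μ ≤ log c + μ/c - 1` summed over the
spectrum. -/
lemma log_det_le {d : ℕ} {A : Matrix (Fin d) (Fin d) ℝ} (hA : A.PosDef) {c : ℝ} (hc : 0 < c)
    (htr : A.trace ≤ d * c) : Real.log A.det ≤ d * Real.log c := by
  have hH := hA.isHermitian
  have h1 : A.det = ∏ i, hH.eigenvalues i := by simpa using hH.det_eq_prod_eigenvalues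
  have h2 : A.trace = ∑ i, hH.eigenvalues i := by simpa using hH.trace_eq_sum_eigenvalues
  have hpos := hA.eigenvalues_pos
  rw [h1, Real.log_prod fun i _ => (hpos i).ne']
  have h3 : ∀ i, Real.log (hH.eigenvalues i) ≤ Real.log c + (hH.eigenvalues i / c - 1) := by
    intro i
    have := Real.log_le_sub_one_of_pos (div_pos (hpos i) hc)
    rw [Real.log_div (hpos i).ne' hc.ne'] at this
    linarith
  refine (Finset.sum_le_sum fun i _ => h3 i).trans ?_
  rw [Finset.sum_add_distrib, Finset.sum_sub_distrib, ← Finset.sum_div, ← h2]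
  simp only [Finset.sum_const, Finset.card_univ, Fintype.card_fin, nsmul_eq_mul, mul_one]
  have : A.trace / c ≤ d := (div_le_iff₀ hc).2 htr
  linarith

end UMA

namespace UMA
open Matrix

/-! ### One round of each kind of expert -/

/-- The bounds that a learning rate of the grid satisfies. -/
structure SmallRate (D G η : ℝ) : Prop where
  pos : 0 < η
  le : η * (D * G) ≤ 1 / 5

lemma smallRate_of_mem {D G η : ℝ} {n : ℕ} (hD : 0 < D) (hG : 0 < G)
    (h : η ∈ learningRates D G n) : SmallRate D G η := by
  obtain ⟨i, -, rfl⟩ := Finset.mem_image.1 h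
  have h2 : (2 : ℝ) ^ (-(i : ℤ)) ≤ 1 := by
    rw [_root_.zpow_neg, zpow_natCast]
    exact inv_le_one_of_one_le₀ (one_le_pow₀ (by norm_num))
  refine ⟨by positivity, ?_⟩
  rw [div_mul_eq_mul_div, div_le_iff₀ (by positivity)]
  nlinarith [mul_pos hD hG]

lemma SmallRate.abs_inner_le {D G η : ℝ} (h : SmallRate D G η) (hG : 0 < G) {d : ℕ}
    {γ w v : Vec d} (hγ : ‖γ‖ ≤ G) (hwv : ‖w - v‖ ≤ D) : |η * inner ℝ γ (w - v)| ≤ 1 / 5 := by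
  rw [abs_mul, abs_of_pos h.pos]
  refine le_trans ?_ h.le
  refine mul_le_mul_of_nonneg_left ?_ h.pos.le
  rw [mul_comm D]
  exact (abs_real_inner_le_norm _ _).trans (mul_le_mul hγ hwv (norm_nonneg _) hG.le)

section Aogd

variable {d : ℕ} {Ω : Set (Vec d)} {D G η : ℝ} {γ w : Vec d} {S : AogdState d}

/-- The second summand of the gradient is at most `2/5` of the bound `η‖γ‖` on the first, and `1.96
= (7/5)²`. -/
lemma norm_surrogateHatGrad_sq_le (hη : SmallRate D G η) {v : Vec d}
    (hγ : ‖γ‖ ≤ G) (hvw : ‖v - w‖ ≤ D) :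
    ‖surrogateHatGrad η γ w v‖ ^ 2 ≤ 1.96 * (η ^ 2 * ‖γ‖ ^ 2) := by
  have h0 := hη.pos
  have hG := (norm_nonneg γ).trans hγ
  have h1 : ‖surrogateHatGrad η γ w v‖ ≤ 1.4 * (η * ‖γ‖) := by
    unfold surrogateHatGrad
    refine (norm_add_le _ _).trans ?_
    rw [norm_smul, norm_smul, Real.norm_of_nonneg h0.le, Real.norm_of_nonneg (by positivity)]
    have h2 : η * (‖γ‖ * ‖v - w‖) ≤ 1 / 5 := by
      refine le_trans ?_ hη.le
      rw [mul_comm D]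
      gcongr
    have h3 : 0 ≤ η * ‖γ‖ := by positivity
    nlinarith [mul_le_mul_of_nonneg_left h2 h3]
  have h4 := pow_le_pow_left₀ (norm_nonneg _) h1 2
  nlinarith

lemma aogdStep_point_mem (hc : IsCompact Ω) (hn : Ω.Nonempty) :
    (aogdStep Ω G η γ w S).point ∈ Ω := proj_mem hc hn _

/-- The surrogate is a quadratic of curvature exactly `2η²‖γ‖²`, which is also the increment of the
inverse step size `a`; so the distance terms telescope. The remainder `‖h‖²/(2a)` is at most
`‖γ‖²/(2N)`, half the increment of `log N` by `1 - 1/x ≤ log x`. -/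
lemma aogdStep_potential (hc : IsCompact Ω) (hΩ : Convex ℝ Ω)
    (hdiam : ∀ x ∈ Ω, ∀ y ∈ Ω, ‖x - y‖ ≤ D) (hG : 0 < G) (hη : SmallRate D G η)
    (hγ : ‖γ‖ ≤ G) (hw : w ∈ Ω) (hS : S.point ∈ Ω) (hg : 0 ≤ S.gradSq) {u : Vec d} (hu : u ∈ Ω) :
    (aogdStep Ω G η γ w S).loss
        + η ^ 2 * (G ^ 2 + (aogdStep Ω G η γ w S).gradSq)
          * ‖(aogdStep Ω G η γ w S).point - u‖ ^ 2
      ≤ S.loss + surrogateHat η γ w u + η ^ 2 * (G ^ 2 + S.gradSq) * ‖S.point - u‖ ^ 2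
        + (Real.log (G ^ 2 + (aogdStep Ω G η γ w S).gradSq) - Real.log (G ^ 2 + S.gradSq)) / 2 := by
  have h0 := hη.pos
  set v := S.point with hv
  set h := surrogateHatGrad η γ w v with hh
  set N := G ^ 2 + (S.gradSq + ‖γ‖ ^ 2) with hN
  have hN0 : 0 < N := by positivity
  set a : ℝ := 2 * η ^ 2 * G ^ 2 + 2 * η ^ 2 * (S.gradSq + ‖γ‖ ^ 2) with ha
  have haN : a = 2 * (η ^ 2 * N) := by rw [ha, hN]; ring
  have ha0 : 0 < a := by rw [haN]; positivity
  have hpr := proj_le hc hΩ (v - (1 / a) • h) hu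
  have e1 : ‖v - (1 / a) • h - u‖ ^ 2
      = ‖v - u‖ ^ 2 - 2 / a * inner ℝ h (v - u) + ‖h‖ ^ 2 / a ^ 2 := by
    rw [show v - (1 / a) • h - u = (v - u) - (1 / a) • h by abel, norm_sub_sq_real,
      inner_smul_right, real_inner_comm, norm_smul, mul_pow, Real.norm_eq_abs, sq_abs]
    ring_nf
  have e2 : surrogateHat η γ w v - surrogateHat η γ w u
      = inner ℝ h (v - u) - η ^ 2 * ‖γ‖ ^ 2 * ‖v - u‖ ^ 2 := by
    have f1 : inner ℝ γ (w - u) = inner ℝ γ (w - v) + inner ℝ γ (v - u) := by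
      rw [← inner_add_right]; congr 1; abel
    have f2 : ‖w - u‖ ^ 2 = ‖w - v‖ ^ 2 - 2 * inner ℝ (v - w) (v - u) + ‖v - u‖ ^ 2 := by
      rw [show w - u = (v - u) - (v - w) by abel, norm_sub_sq_real, norm_sub_rev w v,
        real_inner_comm]
      ring
    rw [hh]
    unfold surrogateHat surrogateHatGrad
    rw [inner_add_left, inner_smul_left, inner_smul_left, f1, f2]
    simp only [conj_trivial]
    ring
  have hb : ‖h‖ ^ 2 / (2 * a) ≤ (Real.log N - Real.log (G ^ 2 + S.gradSq)) / 2 := by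
    have hb1 := norm_surrogateHatGrad_sq_le hη hγ (hdiam v hS w hw)
    have hx : 0 < G ^ 2 + S.gradSq := by positivity
    have hb2 : ‖γ‖ ^ 2 / N ≤ Real.log N - Real.log (G ^ 2 + S.gradSq) := by
      have := Real.log_le_sub_one_of_pos (div_pos hx hN0)
      rw [Real.log_div hx.ne' hN0.ne'] at this
      have e : ‖γ‖ ^ 2 / N = 1 - (G ^ 2 + S.gradSq) / N := by
        rw [eq_sub_iff_add_eq, ← add_div, div_eq_one_iff_eq hN0.ne', hN]; ring
      linarith
    have hb3 : ‖h‖ ^ 2 / (2 * a) ≤ ‖γ‖ ^ 2 / N / 2 := by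
      rw [haN, div_div, div_le_div_iff₀ (by positivity) (by positivity)]
      have : 0 ≤ η ^ 2 * ‖γ‖ ^ 2 := by positivity
      nlinarith
    linarith
  have hmain : a / 2 * ‖proj Ω (v - (1 / a) • h) - u‖ ^ 2
      ≤ a / 2 * ‖v - u‖ ^ 2 - inner ℝ h (v - u) + ‖h‖ ^ 2 / (2 * a) := by
    refine (mul_le_mul_of_nonneg_left hpr (by positivity)).trans (le_of_eq ?_)
    rw [e1]; field_simp
  have g1 : (aogdStep Ω G η γ w S).loss = S.loss + surrogateHat η γ w v := rfl
  have g2 : (aogdStep Ω G η γ w S).gradSq = S.gradSq + ‖γ‖ ^ 2 := rfl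
  have g3 : (aogdStep Ω G η γ w S).point = proj Ω (v - (1 / a) • h) := rfl
  rw [g1, g2, g3, ← hN]
  have e3 : η ^ 2 * N = a / 2 := by rw [haN]; ring
  have e4 : η ^ 2 * (G ^ 2 + S.gradSq) * ‖v - u‖ ^ 2
      = a / 2 * ‖v - u‖ ^ 2 - η ^ 2 * ‖γ‖ ^ 2 * ‖v - u‖ ^ 2 := by
    rw [← e3, hN]; ring
  rw [e3, e4]
  linarith

end Aogd

section Ons

variable {d : ℕ} {Ω : Set (Vec d)} {D G η : ℝ} {γ w : Vec d} {S : OnsState d}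

lemma surrogateGrad_eq (v : Vec d) :
    surrogateGrad η γ w v = (η * (1 - 2 * (η * inner ℝ γ (w - v)))) • γ := by
  rw [surrogateGrad, ← add_smul, ← neg_sub w v, inner_neg_right]
  congr 1; ring

lemma norm_surrogateGrad_sq_le (hD : 0 < D) (hG : 0 < G) (hη : SmallRate D G η) {v : Vec d}
    (hγ : ‖γ‖ ≤ G) (hwv : ‖w - v‖ ≤ D) :
    ‖surrogateGrad η γ w v‖ ^ 2 ≤ (7 / 25) ^ 2 / D ^ 2 := by
  have h0 := hη.pos
  have hy := abs_le.1 (hη.abs_inner_le hG hγ hwv)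
  rw [surrogateGrad_eq, ← div_pow]
  set y := η * inner ℝ γ (w - v)
  refine pow_le_pow_left₀ (norm_nonneg _) ?_ 2
  rw [norm_smul, Real.norm_of_nonneg (mul_nonneg h0.le (by linarith)), le_div_iff₀ hD]
  have h1 : η * ‖γ‖ * D ≤ 1 / 5 := by
    refine le_trans ?_ hη.le
    rw [mul_assoc, mul_comm D]
    gcongr
  have h2 : 0 ≤ η * ‖γ‖ * D := by positivity
  nlinarith

lemma onsStep_point_mem (hc : IsCompact Ω) (hn : Ω.Nonempty) :
    (onsStep Ω η γ w S).point ∈ Ω := genProj_mem hc hn _ _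

lemma posSemidef_vecMulVec_self (h : Fin d → ℝ) : (vecMulVec h h).PosSemidef := by
  simpa using posSemidef_vecMulVec_self_star h

lemma onsStep_sigma_posDef (hS : S.sigma.PosDef) : (onsStep Ω η γ w S).sigma.PosDef :=
  hS.add_posSemidef (posSemidef_vecMulVec_self _)

lemma onsStep_sigma_trace (hD : 0 < D) (hG : 0 < G) (hη : SmallRate D G η)
    (hγ : ‖γ‖ ≤ G) (hwv : ‖w - S.point‖ ≤ D) :
    (onsStep Ω η γ w S).sigma.trace ≤ S.sigma.trace + (7 / 25) ^ 2 / D ^ 2 := by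
  have : (onsStep Ω η γ w S).sigma
    = S.sigma + vecMulVec (surrogateGrad η γ w S.point).ofLp (surrogateGrad η γ w S.point).ofLp := rfl
  rw [this, trace_add, trace_vecMulVec, ← norm_sq_eq_dotProduct]
  have := norm_surrogateGrad_sq_le hD hG hη hγ hwv
  linarith

/-- Along `γ` the surrogate is an exact quadratic: with `y = η⟨γ, w - v⟩` and `m = η⟨γ, v - u⟩` the
difference is `m(1 - 2y) - m²`. The gradient term is `m(1 - 2y)`, and `(1 - 2y)² ≤ 1.96` leaves room
for the coefficient `onsBeta / 2`. -/
lemma surrogate_sub_le (hG : 0 < G) (hη : SmallRate D G η) {v u : Vec d}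
    (hγ : ‖γ‖ ≤ G) (hwv : ‖w - v‖ ≤ D) :
    surrogate η γ w v - surrogate η γ w u
      ≤ inner ℝ (surrogateGrad η γ w v) (v - u)
        - onsBeta / 2 * (inner ℝ (surrogateGrad η γ w v) (v - u)) ^ 2 := by
  have hy := abs_le.1 (hη.abs_inner_le hG hγ hwv)
  have f1 : inner ℝ γ (w - u) = inner ℝ γ (w - v) + inner ℝ γ (v - u) := by
    rw [← inner_add_right]; congr 1; abel
  rw [surrogateGrad_eq, inner_smul_left]
  simp only [conj_trivial, surrogate, f1, onsBeta]
  set y := η * inner ℝ γ (w - v) with hyd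
  set m := η * inner ℝ γ (v - u) with hm
  have e1 : -η * inner ℝ γ (w - v) + η ^ 2 * (inner ℝ γ (w - v)) ^ 2
      - (-η * (inner ℝ γ (w - v) + inner ℝ γ (v - u))
        + η ^ 2 * (inner ℝ γ (w - v) + inner ℝ γ (v - u)) ^ 2) = m * (1 - 2 * y) - m ^ 2 := by
    rw [hyd, hm]; ring
  have e2 : η * (1 - 2 * y) * inner ℝ γ (v - u) = m * (1 - 2 * y) := by rw [hm]; ring
  rw [e1, e2]
  have h1 : (1 - 2 * y) ^ 2 ≤ 1.96 := by nlinarith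
  have h2 := mul_le_mul_of_nonneg_left h1 (sq_nonneg m)
  nlinarith [sq_nonneg m]

/-- The projection does not increase the `A`-distance to `u`. Expanding the Newton step, the
rank-one part of `A` produces `⟨h, v - u⟩²`, which the curvature in `surrogate_sub_le` cancels; the
leftover `hᵀA⁻¹h` is a log-determinant increment. -/
lemma onsStep_potential (hc : IsCompact Ω) (hΩ : Convex ℝ Ω) (hG : 0 < G) (hη : SmallRate D G η)
    (hγ : ‖γ‖ ≤ G) (hwv : ‖w - S.point‖ ≤ D) (hS : S.sigma.PosDef) {u : Vec d} (hu : u ∈ Ω) :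
    (onsStep Ω η γ w S).loss + onsBeta / 2 * (((onsStep Ω η γ w S).point - u).ofLp ⬝ᵥ
        (onsStep Ω η γ w S).sigma *ᵥ ((onsStep Ω η γ w S).point - u).ofLp)
      ≤ S.loss + surrogate η γ w u
        + onsBeta / 2 * ((S.point - u).ofLp ⬝ᵥ S.sigma *ᵥ (S.point - u).ofLp)
        + 1 / (2 * onsBeta)
          * (Real.log (onsStep Ω η γ w S).sigma.det - Real.log S.sigma.det) := by
  have hβ : 0 < onsBeta := by norm_num [onsBeta]
  have hloss := surrogate_sub_le hG hη (u := u) hγ hwv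
  set v := S.point with hv
  set h := surrogateGrad η γ w v with hh
  set A := S.sigma + vecMulVec h.ofLp h.ofLp with hA
  have hApd : A.PosDef := hS.add_posSemidef (posSemidef_vecMulVec_self _)
  have hdet := dotProduct_inv_mulVec_le hS h.ofLp
  rw [← hA] at hdet
  set x := v - (1 / onsBeta) • WithLp.toLp 2 (A⁻¹ *ᵥ h.ofLp) with hx
  have hpr := genProj_le hc hΩ hApd.posSemidef x hu
  set z := (v - u).ofLp with hz
  have hxu : (x - u).ofLp = z + (-(1 / onsBeta)) • (A⁻¹ *ᵥ h.ofLp) := by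
    ext i; simp [hx, hz]; ring_nf
  have hinv : A *ᵥ (A⁻¹ *ᵥ h.ofLp) = h.ofLp := by
    rw [mulVec_mulVec, mul_nonsing_inv _ hApd.det_pos.ne'.isUnit, one_mulVec]
  rw [hxu, quadForm_add hApd.isHermitian, dotProduct_mulVec_comm hApd.isHermitian (A⁻¹ *ᵥ h.ofLp) z, hinv,
    dotProduct_comm (A⁻¹ *ᵥ h.ofLp) h.ofLp] at hpr
  have hzA : z ⬝ᵥ A *ᵥ z = z ⬝ᵥ S.sigma *ᵥ z + (inner ℝ h (v - u)) ^ 2 := by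
    rw [hA, add_mulVec, dotProduct_add, vecMulVec_mulVec, inner_eq_dotProduct]
    simp only [dotProduct_smul, op_smul_eq_smul, smul_eq_mul]
    rw [dotProduct_comm z h.ofLp, ← hz]; ring
  have hzh : z ⬝ᵥ h.ofLp = inner ℝ h (v - u) := by
    rw [inner_eq_dotProduct, dotProduct_comm]
  rw [hzA, hzh] at hpr
  have hmul := mul_le_mul_of_nonneg_left hpr (by positivity : 0 ≤ onsBeta / 2)
  have hmul2 := mul_le_mul_of_nonneg_left hdet (by positivity : 0 ≤ 1 / (2 * onsBeta))
  have e : onsBeta / 2 * (z ⬝ᵥ S.sigma *ᵥ z + (inner ℝ h (v - u)) ^ 2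
        + 2 * -(1 / onsBeta) * inner ℝ h (v - u) + (-(1 / onsBeta)) ^ 2 * (h.ofLp ⬝ᵥ A⁻¹ *ᵥ h.ofLp))
      = onsBeta / 2 * (z ⬝ᵥ S.sigma *ᵥ z) + onsBeta / 2 * (inner ℝ h (v - u)) ^ 2
        - inner ℝ h (v - u) + 1 / (2 * onsBeta) * (h.ofLp ⬝ᵥ A⁻¹ *ᵥ h.ofLp) := by
    field_simp
    ring
  rw [e] at hmul
  have g1 : (onsStep Ω η γ w S).loss = S.loss + surrogate η γ w v := rfl
  have g2 : (onsStep Ω η γ w S).sigma = A := rfl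
  have g3 : (onsStep Ω η γ w S).point = genProj Ω A x := rfl
  rw [g1, g2, g3]
  linarith

end Ons

end UMA

namespace UMA
open Matrix
open scoped Pointwise

/-! ### Admissible data and the submitted point -/

/-- The hypotheses on the domain, the gradients up to round `T` and the starting points. -/
structure Admissible {d : ℕ} (Ω : Set (Vec d)) (D G : ℝ) (T : ℕ) (g : ℕ → Vec d → Vec d)
    (x₀ y₀ : ℕ × ℕ → ℝ → Vec d) : Prop where
  compact : IsCompact Ω
  nonempty : Ω.Nonempty
  convex : Convex ℝ Ω
  D_pos : 0 < D
  G_pos : 0 < G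
  diam : ∀ x ∈ Ω, ∀ y ∈ Ω, ‖x - y‖ ≤ D
  grad : ∀ t ∈ Finset.Icc 1 T, ∀ x ∈ Ω, ‖g t x‖ ≤ G
  ons_mem : ∀ I η, x₀ I η ∈ Ω
  aogd_mem : ∀ I η, y₀ I η ∈ Ω

/-- Convexity without normalization: no positive total is needed, so the statement can be nested for
the sums over rates and over intervals. -/
lemma sum_mem_sum_smul {ι : Type*} {d : ℕ} {Ω : Set (Vec d)} (hΩ : Convex ℝ Ω)
    (hn : Ω.Nonempty) (s : Finset ι) (c : ι → ℝ) (x : ι → Vec d) (hc : ∀ i ∈ s, 0 ≤ c i)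
    (hx : ∀ i ∈ s, ∃ y ∈ Ω, x i = c i • y) : ∃ y ∈ Ω, ∑ i ∈ s, x i = (∑ i ∈ s, c i) • y := by
  classical
  induction s using Finset.induction_on with
  | empty => obtain ⟨y, hy⟩ := hn; exact ⟨y, hy, by simp⟩
  | insert a s ha ih =>
    obtain ⟨y, hy, e⟩ := ih (fun i hi => hc i (Finset.mem_insert_of_mem hi))
      (fun i hi => hx i (Finset.mem_insert_of_mem hi))
    obtain ⟨z, hz, e'⟩ := hx a (Finset.mem_insert_self _ _)
    have hca := hc a (Finset.mem_insert_self _ _)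
    have hcs : 0 ≤ ∑ i ∈ s, c i :=
      Finset.sum_nonneg fun i hi => hc i (Finset.mem_insert_of_mem hi)
    have hmem : c a • z + (∑ i ∈ s, c i) • y ∈ (c a + ∑ i ∈ s, c i) • Ω := by
      rw [hΩ.add_smul hca hcs]
      exact Set.add_mem_add (Set.smul_mem_smul_set hz) (Set.smul_mem_smul_set hy)
    obtain ⟨v, hv, e''⟩ := hmem
    refine ⟨v, hv, ?_⟩
    rw [Finset.sum_insert ha, Finset.sum_insert ha, e, e']
    exact e''.symm

lemma learningRates_nonempty (D G : ℝ) (n : ℕ) : (learningRates D G n).Nonempty :=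
  ⟨_, Finset.mem_image.2 ⟨0, by simp, rfl⟩⟩

lemma activeIntervals_nonempty {t : ℕ} (ht : 1 ≤ t) : (activeIntervals t).Nonempty :=
  ⟨(t, t), (mem_activeIntervals t _).2 ⟨⟨0, t, ht, by simp⟩, le_rfl, le_rfl⟩⟩

/-- The total weight of the active experts. -/
noncomputable def totalWeight {d : ℕ} (D G : ℝ) (t : ℕ) (S : State d) : ℝ :=
  ∑ I ∈ activeIntervals t, ∑ η ∈ learningRates D G (intervalLength I),
      (Real.exp (-(S.ons I η).loss) * η + Real.exp (-(S.aogd I η).loss) * η)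

section Run

variable {d : ℕ} {Ω : Set (Vec d)} {D G : ℝ} {T : ℕ} {g : ℕ → Vec d → Vec d}
  {x₀ y₀ : ℕ × ℕ → ℝ → Vec d}

lemma totalWeight_pos (hD : 0 < D) (hG : 0 < G) {t : ℕ} (ht : 1 ≤ t) (S : State d) :
    0 < totalWeight D G t S := by
  refine Finset.sum_pos (fun I _ => Finset.sum_pos (fun η hη => ?_) (learningRates_nonempty _ _ _))
    (activeIntervals_nonempty ht)
  have := (smallRate_of_mem hD hG hη).pos
  positivity

lemma state_succ (t : ℕ) : state Ω D G g x₀ y₀ (t + 1)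
    = stepState Ω G t (g t (play Ω D G g x₀ y₀ t)) (play Ω D G g x₀ y₀ t)
      (state Ω D G g x₀ y₀ t) := rfl

lemma Admissible.points_mem (h : Admissible Ω D G T g x₀ y₀) (t : ℕ) (I : ℕ × ℕ) (η : ℝ) :
    ((state Ω D G g x₀ y₀ t).ons I η).point ∈ Ω ∧
      ((state Ω D G g x₀ y₀ t).aogd I η).point ∈ Ω := by
  induction t with
  | zero => exact ⟨h.ons_mem I η, h.aogd_mem I η⟩
  | succ t ih =>
    rw [state_succ]
    simp only [stepState]
    split_ifs
    · exact ⟨onsStep_point_mem h.compact h.nonempty, aogdStep_point_mem h.compact h.nonempty⟩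
    · exact ih

lemma Admissible.play_mem (h : Admissible Ω D G T g x₀ y₀) {t : ℕ} (ht : 1 ≤ t) :
    play Ω D G g x₀ y₀ t ∈ Ω := by
  have hW := totalWeight_pos h.D_pos h.G_pos ht (state Ω D G g x₀ y₀ t)
  have hmem := h.points_mem t
  rw [play, combine]
  change (totalWeight D G t _)⁻¹ • _ ∈ Ω
  generalize state Ω D G g x₀ y₀ t = S at *
  have hpos : ∀ I, ∀ η ∈ learningRates D G (intervalLength I),
      0 ≤ Real.exp (-(S.ons I η).loss) * η ∧ 0 ≤ Real.exp (-(S.aogd I η).loss) * η := by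
    intro I η hη
    have := (smallRate_of_mem h.D_pos h.G_pos hη).pos
    constructor <;> positivity
  obtain ⟨y, hy, e⟩ := sum_mem_sum_smul h.convex h.nonempty (activeIntervals t)
    (fun I => ∑ η ∈ learningRates D G (intervalLength I),
      (Real.exp (-(S.ons I η).loss) * η + Real.exp (-(S.aogd I η).loss) * η))
    (fun I => ∑ η ∈ learningRates D G (intervalLength I),
      ((Real.exp (-(S.ons I η).loss) * η) • (S.ons I η).point
        + (Real.exp (-(S.aogd I η).loss) * η) • (S.aogd I η).point))
    (fun I _ => Finset.sum_nonneg fun η hη => add_nonneg (hpos I η hη).1 (hpos I η hη).2)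
    (fun I _ => sum_mem_sum_smul h.convex h.nonempty _ _ _
      (fun η hη => add_nonneg (hpos I η hη).1 (hpos I η hη).2) fun η hη => by
        have : (Real.exp (-(S.ons I η).loss) * η) • (S.ons I η).point
            + (Real.exp (-(S.aogd I η).loss) * η) • (S.aogd I η).point
            ∈ (Real.exp (-(S.ons I η).loss) * η + Real.exp (-(S.aogd I η).loss) * η) • Ω := by
          rw [h.convex.add_smul (hpos I η hη).1 (hpos I η hη).2]
          exact Set.add_mem_add (Set.smul_mem_smul_set (hmem I η).1)
            (Set.smul_mem_smul_set (hmem I η).2)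
        obtain ⟨y, hy, e⟩ := this
        exact ⟨y, hy, e.symm⟩)
  rw [e]
  change (totalWeight D G t S)⁻¹ • totalWeight D G t S • y ∈ Ω
  rwa [inv_smul_smul₀ hW.ne']

/-- The submitted point is the barycenter of the predictions. -/
lemma sum_weighted_sub_play (hD : 0 < D) (hG : 0 < G) {t : ℕ} (ht : 1 ≤ t) (S : State d) :
    ∑ I ∈ activeIntervals t, ∑ η ∈ learningRates D G (intervalLength I),
      ((Real.exp (-(S.ons I η).loss) * η) • (combine D G t S - (S.ons I η).point)
        + (Real.exp (-(S.aogd I η).loss) * η) • (combine D G t S - (S.aogd I η).point)) = 0 := by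
  have hW := totalWeight_pos hD hG ht S
  have e : totalWeight D G t S • combine D G t S
      = ∑ I ∈ activeIntervals t, ∑ η ∈ learningRates D G (intervalLength I),
      ((Real.exp (-(S.ons I η).loss) * η) • (S.ons I η).point
        + (Real.exp (-(S.aogd I η).loss) * η) • (S.aogd I η).point) := by
    rw [combine]
    exact smul_inv_smul₀ hW.ne' _
  rw [← sub_eq_zero.2 e, totalWeight, Finset.sum_smul, ← Finset.sum_sub_distrib]
  refine Finset.sum_congr rfl fun I _ => ?_
  rw [Finset.sum_smul, ← Finset.sum_sub_distrib]
  refine Finset.sum_congr rfl fun η _ => ?_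
  rw [smul_sub, smul_sub, add_smul]
  abel

/-! ### The number of experts -/

/-- The geometric covering intervals that start in one of the rounds `1, …, q`. -/
def startedIntervals (q : ℕ) : Finset (ℕ × ℕ) :=
  ((Finset.range q).sigma fun k => Finset.Icc 1 (q / 2 ^ k)).image
    fun x => (x.2 * 2 ^ x.1, (x.2 + 1) * 2 ^ x.1 - 1)

lemma mem_startedIntervals {q : ℕ} {I : ℕ × ℕ} :
    I ∈ startedIntervals q ↔ I ∈ gcIntervals ∧ I.1 ≤ q := by
  simp only [startedIntervals, Finset.mem_image, Finset.mem_sigma, Finset.mem_range,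
    Finset.mem_Icc]
  constructor
  · rintro ⟨⟨k, i⟩, ⟨-, hi1, hi2⟩, rfl⟩
    exact ⟨⟨k, i, hi1, rfl⟩, (Nat.le_div_iff_mul_le (by positivity)).1 hi2⟩
  · rintro ⟨⟨k, i, hi, rfl⟩, h⟩
    refine ⟨⟨k, i⟩, ⟨?_, hi, (Nat.le_div_iff_mul_le (by positivity)).2 h⟩, rfl⟩
    -- Scales `k < q` suffice, because `k < 2^k ≤ i · 2^k ≤ q`.
    have h1 : 2 ^ k ≤ i * 2 ^ k := Nat.le_mul_of_pos_left _ hi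
    have h2 : k < 2 ^ k := Nat.lt_two_pow_self
    simp only at h ⊢
    omega

lemma card_learningRates_le (D G : ℝ) (k : ℕ) : (learningRates D G (2 ^ k)).card ≤ 2 ^ k := by
  refine Finset.card_image_le.trans ?_
  rw [Finset.card_range]
  refine le_trans (Nat.succ_le_succ ?_) (Nat.lt_two_pow_self (n := k))
  rw [Nat.ceil_le]
  push_cast
  rw [← Real.rpow_natCast, Real.logb_rpow (by norm_num) (by norm_num)]
  have : (0 : ℝ) ≤ k := by positivity
  linarith

/-- At scale `2^k` there are `⌊q/2^k⌋` intervals with at most `2^k` rates each, hence at most `q`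
pairs per scale, and there are `q` scales. -/
lemma sum_card_learningRates_le (D G : ℝ) (q : ℕ) :
    ∑ I ∈ startedIntervals q, (learningRates D G (intervalLength I)).card ≤ q ^ 2 := by
  have hlen : ∀ k i : ℕ, intervalLength (i * 2 ^ k, (i + 1) * 2 ^ k - 1) = 2 ^ k := by
    intro k i
    have hk : 1 ≤ 2 ^ k := Nat.one_le_two_pow
    have : (i + 1) * 2 ^ k = i * 2 ^ k + 2 ^ k := by ring
    simp only [intervalLength]; omega
  rw [startedIntervals, Finset.sum_image]
  · rw [Finset.sum_sigma, pow_two]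
    calc _ ≤ ∑ k ∈ Finset.range q, q := Finset.sum_le_sum fun k _ => ?_
      _ = q * q := by simp
    calc _ ≤ ∑ i ∈ Finset.Icc 1 (q / 2 ^ k), 2 ^ k := Finset.sum_le_sum fun i _ => by
            simp only [hlen]; exact card_learningRates_le D G k
      _ = q / 2 ^ k * 2 ^ k := by simp
      _ ≤ q := Nat.div_mul_le_self _ _
  · rintro ⟨k, i⟩ - ⟨k', i'⟩ - h
    simp only [Prod.mk.injEq] at h
    have hl : (2 : ℕ) ^ k = 2 ^ k' := by
      rw [← hlen k i, ← hlen k' i', h.1, h.2]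
    obtain rfl : k = k' := Nat.pow_right_injective le_rfl hl
    have : i = i' := Nat.eq_of_mul_eq_mul_right (by positivity) h.1
    rw [this]

/-! ### The meta-algorithm -/

/-- With `y = η⟨γ, w - v⟩` this is `y - y² ≤ log (1 + y)` for `|y| ≤ 1/5`: the Taylor remainder
after the quadratic term is at most `y²/4`, so `log (1 + y) ≥ y - 3y²/4`. -/
lemma exp_neg_surrogate_le {η : ℝ} (hη : SmallRate D G η) (hG : 0 < G) {γ w v : Vec d}
    (hγ : ‖γ‖ ≤ G) (hwv : ‖w - v‖ ≤ D) :
    Real.exp (-surrogate η γ w v) ≤ 1 + η * inner ℝ γ (w - v) := by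
  have hy := abs_le.1 (hη.abs_inner_le hG hγ hwv)
  have e : -surrogate η γ w v
      = η * inner ℝ γ (w - v) - (η * inner ℝ γ (w - v)) ^ 2 := by
    rw [surrogate]; ring
  rw [e]
  set y := η * inner ℝ γ (w - v)
  have hpos : 0 < 1 + y := by linarith
  rw [← Real.le_log_iff_exp_le hpos]
  have h2 := Real.abs_log_sub_add_sum_range_le (x := -y) (by rw [abs_lt]; constructor <;> linarith) 2
  have h3 : |-y| ^ (2 + 1) / (1 - |-y|) ≤ y ^ 2 / 4 := by
    have hy5 : |y| ≤ 1 / 5 := abs_le.2 hy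
    rw [abs_neg, div_le_iff₀ (by linarith), pow_succ, sq_abs]
    nlinarith [sq_nonneg y]
  have h4 := (abs_le.1 (h2.trans h3)).1
  norm_num [Finset.sum_range_succ] at h4
  nlinarith

/-- Cauchy–Schwarz. It transfers the exponential inequality to the second kind of expert. -/
lemma surrogate_le_surrogateHat (η : ℝ) (γ w v : Vec d) :
    surrogate η γ w v ≤ surrogateHat η γ w v := by
  unfold surrogate surrogateHat
  rw [mul_assoc (η ^ 2), ← mul_pow ‖γ‖]
  refine add_le_add_right (mul_le_mul_of_nonneg_left ?_ (sq_nonneg η)) _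
  exact sq_le_sq' (neg_le_of_abs_le (abs_real_inner_le_norm _ _)) (real_inner_le_norm _ _)

/-- The unnormalized potential of all experts that are created up to round `q`. -/
noncomputable def potential (D G : ℝ) (q : ℕ) (S : State d) : ℝ :=
  ∑ I ∈ startedIntervals q, ∑ η ∈ learningRates D G (intervalLength I),
    (Real.exp (-(S.ons I η).loss) + Real.exp (-(S.aogd I η).loss))

/-- Sleeping experts do not move. For active ones the linear terms add up to `⟨γ, ·⟩` of a sum of
tilted weights times `w - v`, which vanishes by the choice of `w`; the factor `η` in the weights is
what matches the `η` in the exponential inequality. -/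
lemma Admissible.potential_succ_le (h : Admissible Ω D G T g x₀ y₀) {q t : ℕ} (ht : 1 ≤ t)
    (htq : t ≤ q) (htT : t ≤ T) :
    potential D G q (state Ω D G g x₀ y₀ (t + 1)) ≤ potential D G q (state Ω D G g x₀ y₀ t) := by
  have hpm := h.points_mem t
  have hw : play Ω D G g x₀ y₀ t ∈ Ω := h.play_mem ht
  have hγ := h.grad t (Finset.mem_Icc.2 ⟨ht, htT⟩) _ hw
  rw [state_succ]
  have hbar := sum_weighted_sub_play h.D_pos h.G_pos ht (state Ω D G g x₀ y₀ t)
  change ∑ I ∈ activeIntervals t, ∑ η ∈ learningRates D G (intervalLength I),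
    (_ • (play Ω D G g x₀ y₀ t - _) + _ • (play Ω D G g x₀ y₀ t - _)) = 0 at hbar
  generalize state Ω D G g x₀ y₀ t = S at *
  generalize play Ω D G g x₀ y₀ t = w at *
  generalize g t w = γ at *
  have hact : activeIntervals t
      = (startedIntervals q).filter fun I => I.1 ≤ t ∧ t ≤ I.2 := by
    ext I
    rw [mem_activeIntervals, Finset.mem_filter, mem_startedIntervals]
    constructor
    · rintro ⟨h1, h2, h3⟩; exact ⟨⟨h1, h2.trans htq⟩, h2, h3⟩
    · rintro ⟨⟨h1, -⟩, h2, h3⟩; exact ⟨h1, h2, h3⟩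
  have hstep : potential D G q (stepState Ω G t γ w S) ≤ potential D G q S
      + ∑ I ∈ startedIntervals q, if I.1 ≤ t ∧ t ≤ I.2 then
        ∑ η ∈ learningRates D G (intervalLength I),
          inner ℝ γ ((Real.exp (-(S.ons I η).loss) * η) • (w - (S.ons I η).point)
          + (Real.exp (-(S.aogd I η).loss) * η) • (w - (S.aogd I η).point)) else 0 := by
    unfold potential
    rw [← Finset.sum_add_distrib]
    refine Finset.sum_le_sum fun I _ => ?_
    simp only [stepState]
    split_ifs
    · rw [← Finset.sum_add_distrib]
      refine Finset.sum_le_sum fun η hη => ?_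
      have hs := smallRate_of_mem h.D_pos h.G_pos hη
      have e1 := exp_neg_surrogate_le hs h.G_pos hγ (h.diam w hw _ (hpm I η).1)
      have e2 := (Real.exp_le_exp.2 (neg_le_neg (surrogate_le_surrogateHat η γ w
        (S.aogd I η).point))).trans
        (exp_neg_surrogate_le hs h.G_pos hγ (h.diam w hw _ (hpm I η).2))
      have f1 : (onsStep Ω η γ w (S.ons I η)).loss
        = (S.ons I η).loss + surrogate η γ w (S.ons I η).point := rfl
      have f2 : (aogdStep Ω G η γ w (S.aogd I η)).loss
        = (S.aogd I η).loss + surrogateHat η γ w (S.aogd I η).point := rfl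
      rw [f1, f2, neg_add, neg_add, Real.exp_add, Real.exp_add, inner_add_right,
        inner_smul_right, inner_smul_right]
      have := mul_le_mul_of_nonneg_left e1 (Real.exp_pos (-(S.ons I η).loss)).le
      have := mul_le_mul_of_nonneg_left e2 (Real.exp_pos (-(S.aogd I η).loss)).le
      linarith
    · simp
  rw [← Finset.sum_filter, ← hact] at hstep
  simp only [← inner_sum, hbar, inner_zero_right, add_zero] at hstep
  exact hstep

lemma one_le_of_mem_gcIntervals {I : ℕ × ℕ} (hI : I ∈ gcIntervals) : 1 ≤ I.1 := by
  obtain ⟨k, i, hi, rfl⟩ := hI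
  exact Nat.mul_pos hi (by positivity)

lemma state_before {I : ℕ × ℕ} (η : ℝ) (t : ℕ) (ht : t ≤ I.1) :
    (state Ω D G g x₀ y₀ t).ons I η = onsInit D (x₀ I η) ∧
      (state Ω D G g x₀ y₀ t).aogd I η = aogdInit (y₀ I η) := by
  induction t with
  | zero => exact ⟨rfl, rfl⟩
  | succ t ih =>
    rw [state_succ]
    simp only [stepState]
    rw [if_neg (by omega), if_neg (by omega)]
    exact ih (by omega)

lemma Admissible.potential_le (h : Admissible Ω D G T g x₀ y₀) {q : ℕ} (hq : q ≤ T) (t : ℕ)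
    (ht : t ≤ q) : potential D G q (state Ω D G g x₀ y₀ (t + 1)) ≤ 2 * (q : ℝ) ^ 2 := by
  induction t with
  | zero =>
    have e : potential D G q (state Ω D G g x₀ y₀ (0 + 1))
        = ((2 * ∑ I ∈ startedIntervals q, (learningRates D G (intervalLength I)).card : ℕ) : ℝ) := by
      rw [potential]
      push_cast
      rw [Finset.mul_sum]
      refine Finset.sum_congr rfl fun I hI => ?_
      have h1 := one_le_of_mem_gcIntervals (mem_startedIntervals.1 hI).1
      have : ∀ η ∈ learningRates D G (intervalLength I),
          Real.exp (-((state Ω D G g x₀ y₀ (0 + 1)).ons I η).loss)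
          + Real.exp (-((state Ω D G g x₀ y₀ (0 + 1)).aogd I η).loss) = 2 := by
        intro η _
        rw [(state_before η 1 h1).1, (state_before η 1 h1).2]
        -- Index `1` is the state before round `1`, when every loss is zero; each pair contributes
        -- one unit per kind of expert.
        norm_num [onsInit, aogdInit]
      rw [Finset.sum_congr rfl this]
      simp [mul_comm]
    rw [e]
    have := sum_card_learningRates_le D G q
    exact_mod_cast Nat.mul_le_mul_left 2 this
  | succ t ih =>
    exact (h.potential_succ_le (by omega) ht (by omega)).trans (ih (by omega))

/-- The meta-regret: no expert beats the submitted points by much. -/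
lemma Admissible.loss_ge (h : Admissible Ω D G T g x₀ y₀) {q t : ℕ} (hq : q ≤ T) (ht : t ≤ q)
    (hq1 : 1 ≤ q) {I : ℕ × ℕ} (hI : I ∈ gcIntervals) (hIq : I.1 ≤ q) {η : ℝ}
    (hη : η ∈ learningRates D G (intervalLength I)) :
    -(2 * Real.logb 2 (2 * q)) ≤ ((state Ω D G g x₀ y₀ (t + 1)).ons I η).loss ∧
      -(2 * Real.logb 2 (2 * q)) ≤ ((state Ω D G g x₀ y₀ (t + 1)).aogd I η).loss := by
  have hpot := h.potential_le hq t ht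
  generalize state Ω D G g x₀ y₀ (t + 1) = S at *
  have hq1' : (1 : ℝ) ≤ q := by exact_mod_cast hq1
  have h1 : Real.exp (-(S.ons I η).loss) + Real.exp (-(S.aogd I η).loss) ≤ 2 * (q : ℝ) ^ 2 := by
    refine le_trans ?_ hpot
    refine le_trans ?_ (Finset.single_le_sum (fun J _ => Finset.sum_nonneg fun η _ => by positivity)
      (mem_startedIntervals.2 ⟨hI, hIq⟩))
    exact Finset.single_le_sum
      (f := fun η => Real.exp (-(S.ons I η).loss) + Real.exp (-(S.aogd I η).loss))
      (fun η _ => by positivity) hη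
  -- The slack is used twice: `2q² ≤ (2q)²`, and `log x ≤ log₂ x` for `x ≥ 1`.
  have hlog : Real.log ((2 * q) ^ 2) ≤ 2 * Real.logb 2 (2 * q) := by
    rw [Real.log_pow, Real.logb]
    push_cast
    have h2 : 0 ≤ Real.log (2 * (q : ℝ)) := Real.log_nonneg (by linarith)
    have h3 : Real.log 2 ≤ 1 := by linarith [Real.log_two_lt_d9]
    have := le_div_self h2 (Real.log_pos (by norm_num)) h3
    linarith
  have key : ∀ x : ℝ, Real.exp (-x) ≤ 2 * (q : ℝ) ^ 2 → -(2 * Real.logb 2 (2 * q)) ≤ x := by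
    intro x hx
    have : -x ≤ Real.log ((2 * q) ^ 2) := by
      rw [Real.le_log_iff_exp_le (by positivity)]
      nlinarith
    linarith
  exact ⟨key _ (by linarith [Real.exp_pos (-(S.aogd I η).loss)]),
    key _ (by linarith [Real.exp_pos (-(S.ons I η).loss)])⟩

/-! ### Regret of the experts -/

/-- Telescoping of `onsStep_potential` over the first `n` rounds of `I`. The initial matrix makes
the starting distance term at most `1/(2β₀)`, and the trace is carried along to bound the
determinant at the end. -/
lemma Admissible.ons_potential (h : Admissible Ω D G T g x₀ y₀) {I : ℕ × ℕ} {η : ℝ}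
    (hI : 1 ≤ I.1) (hIT : I.2 ≤ T) (hη : SmallRate D G η) {u : Vec d} (hu : u ∈ Ω) (n : ℕ)
    (hn : I.1 + n ≤ I.2 + 1) :
    let S := (state Ω D G g x₀ y₀ (I.1 + n)).ons I η
    let w := play Ω D G g x₀ y₀
    S.sigma.PosDef ∧
    S.sigma.trace ≤ d * (1 / (onsBeta ^ 2 * D ^ 2)) + n * ((7 / 25) ^ 2 / D ^ 2) ∧
    S.loss + onsBeta / 2 * ((S.point - u).ofLp ⬝ᵥ S.sigma *ᵥ (S.point - u).ofLp)
      ≤ ∑ t ∈ Finset.Ico I.1 (I.1 + n), surrogate η (g t (w t)) (w t) u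
        + 1 / (2 * onsBeta)
        + 1 / (2 * onsBeta)
          * (Real.log S.sigma.det - d * Real.log (1 / (onsBeta ^ 2 * D ^ 2))) := by
  have hβ : 0 < onsBeta := by norm_num [onsBeta]
  have hD := h.D_pos
  induction n with
  | zero =>
    have e := (state_before (Ω := Ω) (D := D) (G := G) (g := g) (x₀ := x₀) (y₀ := y₀)
      (I := I) η (I.1 + 0) le_rfl).1
    simp only [e, onsInit]
    set c := 1 / (onsBeta ^ 2 * D ^ 2) with hc
    have hc0 : 0 < c := by positivity
    refine ⟨PosDef.one.smul hc0, by simp [mul_comm], ?_⟩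
    have hdet : Real.log (c • (1 : Matrix (Fin d) (Fin d) ℝ)).det = d * Real.log c := by
      simp [Real.log_pow]
    rw [hdet, smul_mulVec, one_mulVec, dotProduct_smul, ← norm_sq_eq_dotProduct]
    have h1 : ‖x₀ I η - u‖ ^ 2 ≤ D ^ 2 :=
      pow_le_pow_left₀ (norm_nonneg _) (h.diam _ (h.ons_mem I η) u hu) 2
    have h2 : onsBeta / 2 * (c • ‖x₀ I η - u‖ ^ 2) ≤ 1 / (2 * onsBeta) := by
      rw [smul_eq_mul]
      calc onsBeta / 2 * (c * ‖x₀ I η - u‖ ^ 2) ≤ onsBeta / 2 * (c * D ^ 2) := by gcongr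
        _ = _ := by rw [hc]; field_simp
    simpa using h2
  | succ n ih =>
    obtain ⟨h1, h2, h3⟩ := ih (by omega)
    have hw : play Ω D G g x₀ y₀ (I.1 + n) ∈ Ω := h.play_mem (by omega)
    have hγ := h.grad (I.1 + n) (Finset.mem_Icc.2 ⟨by omega, by omega⟩) _ hw
    have hp := (h.points_mem (I.1 + n) I η).1
    have hd := h.diam _ hw _ hp
    have e : (state Ω D G g x₀ y₀ (I.1 + (n + 1))).ons I η
        = onsStep Ω η (g (I.1 + n) (play Ω D G g x₀ y₀ (I.1 + n))) (play Ω D G g x₀ y₀ (I.1 + n))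
          ((state Ω D G g x₀ y₀ (I.1 + n)).ons I η) := by
      rw [← add_assoc, state_succ]
      exact if_pos ⟨by omega, by omega⟩
    simp only [e]
    have h4 := onsStep_potential h.compact h.convex h.G_pos hη hγ hd h1 hu
    have h5 := onsStep_sigma_trace (Ω := Ω) hD h.G_pos hη hγ hd
    refine ⟨onsStep_sigma_posDef h1, ?_, ?_⟩
    · push_cast; linarith
    · rw [← add_assoc, Finset.sum_Ico_succ_top (by omega)]
      linarith

lemma Admissible.ons_regret (h : Admissible Ω D G T g x₀ y₀) {I : ℕ × ℕ} {η : ℝ}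
    (hI : 1 ≤ I.1) (hI2 : I.1 ≤ I.2) (hIT : I.2 ≤ T) (hη : SmallRate D G η) {u : Vec d}
    (hu : u ∈ Ω) :
    ((state Ω D G g x₀ y₀ (I.2 + 1)).ons I η).loss
      ≤ ∑ t ∈ Finset.Icc I.1 I.2,
          surrogate η (g t (play Ω D G g x₀ y₀ t)) (play Ω D G g x₀ y₀ t) u
        + (5 * d * Real.log (intervalLength I + 1) + 5) := by
  have hβ : 0 < onsBeta := by norm_num [onsBeta]
  have hD := h.D_pos
  set n := intervalLength I with hn
  have hn1 : I.1 + n = I.2 + 1 := by rw [hn, intervalLength]; omega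
  obtain ⟨h1, h2, h3⟩ := h.ons_potential hI hIT hη hu n hn1.le
  rw [hn1] at h1 h2 h3
  set S := (state Ω D G g x₀ y₀ (I.2 + 1)).ons I η
  set c := 1 / (onsBeta ^ 2 * D ^ 2) with hc
  have hc0 : 0 < c := by positivity
  -- Each round adds at most `(7/25)²/D²` to the trace, while `c = (56/25)²/D²`; so the mean
  -- eigenvalue stays below `c(n + 1)`, and `log det` grows by at most `d log (n + 1)`.
  have hcc : (7 / 25) ^ 2 / D ^ 2 ≤ c := by
    rw [hc, onsBeta, div_le_div_iff₀ (by positivity) (by positivity)]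
    nlinarith [sq_nonneg D]
  have htr : S.sigma.trace ≤ d * (c * (n + 1)) := by
    -- The increment of the trace carries no factor `d`; inserting one needs `d ≥ 1`, and for `d =
    -- 0` the trace is zero.
    rcases Nat.eq_zero_or_pos d with rfl | hd
    · simp [Matrix.trace]
    · have hd' : (1 : ℝ) ≤ d := by exact_mod_cast hd
      have : (n : ℝ) * ((7 / 25) ^ 2 / D ^ 2) ≤ d * (n * c) := by
        have h6 := mul_le_mul_of_nonneg_left hcc (by positivity : (0 : ℝ) ≤ n)
        have h7 : 0 ≤ (n : ℝ) * c := by positivity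
        nlinarith
      linarith
  have hld := log_det_le h1 (by positivity) htr
  rw [Real.log_mul hc0.ne' (by positivity)] at hld
  have hq : 0 ≤ onsBeta / 2 * ((S.point - u).ofLp ⬝ᵥ S.sigma *ᵥ (S.point - u).ofLp) := by
    have := h1.posSemidef.dotProduct_mulVec_nonneg (S.point - u).ofLp
    rw [star_trivial] at this
    positivity
  have hlog : 0 ≤ (d : ℝ) * Real.log (n + 1) :=
    mul_nonneg (by positivity) (Real.log_nonneg (by linarith [(Nat.cast_nonneg n : (0 : ℝ) ≤ n)]))
  have hIco : Finset.Ico I.1 (I.2 + 1) = Finset.Icc I.1 I.2 := by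
    ext t; simp only [Finset.mem_Ico, Finset.mem_Icc]; omega
  rw [hIco] at h3
  have hb : 1 / (2 * onsBeta) = 28 / 25 := by norm_num [onsBeta]
  rw [hb] at h3
  nlinarith

lemma Admissible.aogd_potential (h : Admissible Ω D G T g x₀ y₀) {I : ℕ × ℕ} {η : ℝ}
    (hI : 1 ≤ I.1) (hIT : I.2 ≤ T) (hη : SmallRate D G η) {u : Vec d} (hu : u ∈ Ω) (n : ℕ)
    (hn : I.1 + n ≤ I.2 + 1) :
    let S := (state Ω D G g x₀ y₀ (I.1 + n)).aogd I η
    let w := play Ω D G g x₀ y₀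
    0 ≤ S.gradSq ∧ S.gradSq ≤ n * G ^ 2 ∧
    S.loss + η ^ 2 * (G ^ 2 + S.gradSq) * ‖S.point - u‖ ^ 2
      ≤ ∑ t ∈ Finset.Ico I.1 (I.1 + n), surrogateHat η (g t (w t)) (w t) u
        + 1 / 25 + (Real.log (G ^ 2 + S.gradSq) - Real.log (G ^ 2)) / 2 := by
  have hG := h.G_pos
  have hη0 := hη.pos
  induction n with
  | zero =>
    have e := (state_before (Ω := Ω) (D := D) (G := G) (g := g) (x₀ := x₀) (y₀ := y₀)
      (I := I) η (I.1 + 0) le_rfl).2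
    simp only [e, aogdInit]
    refine ⟨le_rfl, by simp, ?_⟩
    have h1 : ‖y₀ I η - u‖ ≤ D := h.diam _ (h.aogd_mem I η) u hu
    have h2 : η * (G * ‖y₀ I η - u‖) ≤ 1 / 5 := by
      refine le_trans ?_ hη.le
      rw [mul_comm D]; gcongr
    have h3 := pow_le_pow_left₀ (by positivity) h2 2
    simp
    nlinarith
  | succ n ih =>
    obtain ⟨h1, h2, h3⟩ := ih (by omega)
    have hw : play Ω D G g x₀ y₀ (I.1 + n) ∈ Ω := h.play_mem (by omega)
    have hγ := h.grad (I.1 + n) (Finset.mem_Icc.2 ⟨by omega, by omega⟩) _ hw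
    have hp := (h.points_mem (I.1 + n) I η).2
    have e : (state Ω D G g x₀ y₀ (I.1 + (n + 1))).aogd I η
        = aogdStep Ω G η (g (I.1 + n) (play Ω D G g x₀ y₀ (I.1 + n)))
          (play Ω D G g x₀ y₀ (I.1 + n)) ((state Ω D G g x₀ y₀ (I.1 + n)).aogd I η) := by
      rw [← add_assoc, state_succ]
      exact if_pos ⟨by omega, by omega⟩
    simp only [e]
    have h4 := aogdStep_potential h.compact h.convex h.diam hG hη hγ hw hp h1 hu
    have e2 : (aogdStep Ω G η (g (I.1 + n) (play Ω D G g x₀ y₀ (I.1 + n)))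
          (play Ω D G g x₀ y₀ (I.1 + n)) ((state Ω D G g x₀ y₀ (I.1 + n)).aogd I η)).gradSq
        = ((state Ω D G g x₀ y₀ (I.1 + n)).aogd I η).gradSq
          + ‖g (I.1 + n) (play Ω D G g x₀ y₀ (I.1 + n))‖ ^ 2 := rfl
    have h5 := pow_le_pow_left₀ (norm_nonneg _) hγ 2
    refine ⟨?_, ?_, ?_⟩
    · rw [e2]; positivity
    · rw [e2]; push_cast; linarith
    · rw [← add_assoc, Finset.sum_Ico_succ_top (by omega)]
      linarith

lemma Admissible.aogd_regret (h : Admissible Ω D G T g x₀ y₀) {I : ℕ × ℕ} {η : ℝ}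
    (hI : 1 ≤ I.1) (hI2 : I.1 ≤ I.2) (hIT : I.2 ≤ T) (hη : SmallRate D G η) {u : Vec d}
    (hu : u ∈ Ω) :
    ((state Ω D G g x₀ y₀ (I.2 + 1)).aogd I η).loss
      ≤ ∑ t ∈ Finset.Icc I.1 I.2,
          surrogateHat η (g t (play Ω D G g x₀ y₀ t)) (play Ω D G g x₀ y₀ t) u
        + (1 + Real.log (intervalLength I + 1)) := by
  have hG := h.G_pos
  set n := intervalLength I with hn
  have hn1 : I.1 + n = I.2 + 1 := by rw [hn, intervalLength]; omega
  obtain ⟨h1, h2, h3⟩ := h.aogd_potential hI hIT hη hu n hn1.le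
  rw [hn1] at h1 h2 h3
  set S := (state Ω D G g x₀ y₀ (I.2 + 1)).aogd I η
  have hIco : Finset.Ico I.1 (I.2 + 1) = Finset.Icc I.1 I.2 := by
    ext t; simp only [Finset.mem_Ico, Finset.mem_Icc]; omega
  rw [hIco] at h3
  have hlog : 0 ≤ Real.log ((n : ℝ) + 1) :=
    Real.log_nonneg (by linarith [(Nat.cast_nonneg n : (0 : ℝ) ≤ n)])
  -- All gradients are at most `G`, so the logarithms telescope to a ratio of at most `n + 1`,
  -- independent of `G`.
  have h4 : Real.log (G ^ 2 + S.gradSq) ≤ Real.log (G ^ 2) + Real.log ((n : ℝ) + 1) := by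
    rw [← Real.log_mul (by positivity) (by positivity)]
    exact Real.log_le_log (by positivity) (by linarith)
  have h5 : 0 ≤ η ^ 2 * (G ^ 2 + S.gradSq) * ‖S.point - u‖ ^ 2 := by positivity
  linarith

end Run

end UMA

namespace UMA

/-! ### Consequences of convexity and exp-concavity -/

/-- The derivative is only relative to `Ω`, so the function is restricted to the segment from `w` to
`u` and compared with its slope there. -/
lemma convexOn_add_fderiv_le {d : ℕ} {Ω : Set (Vec d)} {φ : Vec d → ℝ} (hφ : ConvexOn ℝ Ω φ)
    {φ' : Vec d →L[ℝ] ℝ} {w u : Vec d} (h : HasFDerivWithinAt φ φ' Ω w) (hw : w ∈ Ω)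
    (hu : u ∈ Ω) : φ w + φ' (u - w) ≤ φ u := by
  set L : ℝ →ᵃ[ℝ] Vec d := AffineMap.lineMap w u with hL
  have h0 : L 0 = w := AffineMap.lineMap_apply_zero w u
  have h1 : L 1 = u := AffineMap.lineMap_apply_one w u
  have hd : HasDerivWithinAt (φ ∘ L) (φ' (u - w)) (L ⁻¹' Ω) 0 :=
    h.comp_hasDerivWithinAt_of_eq 0 AffineMap.hasDerivWithinAt_lineMap
      (Set.mapsTo_preimage _ _) h0.symm
  have := (hφ.comp_affineMap L).le_slope_of_hasDerivWithinAt (x := 0) (y := 1)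
    (by rw [Set.mem_preimage, h0]; exact hw) (by rw [Set.mem_preimage, h1]; exact hu)
    zero_lt_one hd
  rw [slope_def_field] at this
  simp only [Function.comp, h0, h1, sub_zero, div_one] at this
  linarith

lemma convexOn_sub_le_inner {d : ℕ} {Ω : Set (Vec d)} {f : Vec d → ℝ} (hf : ConvexOn ℝ Ω f)
    {γ w u : Vec d} (h : HasGradientWithinAt f γ Ω w) (hw : w ∈ Ω) (hu : u ∈ Ω) :
    f w - f u ≤ inner ℝ γ (w - u) := by
  have := convexOn_add_fderiv_le hf h.hasFDerivWithinAt hw hu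
  rw [InnerProductSpace.toDual_apply_apply, ← neg_sub w u, inner_neg_right] at this
  linarith

/-- The cubic term and the Taylor remainder are each at most `y²/12`, which leaves `y - y²/3`. -/
lemma log_one_add_le {y : ℝ} (hy : |y| ≤ 1 / 4) : Real.log (1 + y) ≤ y - y ^ 2 / 4 := by
  have h2 := Real.abs_log_sub_add_sum_range_le (x := -y) (by rw [abs_neg]; linarith) 3
  have h3 : |-y| ^ (3 + 1) / (1 - |-y|) ≤ y ^ 2 / 12 := by
    have h0 := abs_nonneg y
    rw [abs_neg, div_le_iff₀ (by linarith), ← sq_abs y]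
    have h4 : |y| ^ 2 ≤ 1 / 16 := by nlinarith
    nlinarith [sq_nonneg |y|]
  have h4 := (abs_le.1 (h2.trans h3)).2
  norm_num [Finset.sum_range_succ] at h4
  have h5 : y ^ 3 ≤ y ^ 2 * (1 / 4) := by
    rw [pow_succ]
    exact mul_le_mul_of_nonneg_left ((le_abs_self y).trans hy) (sq_nonneg y)
  nlinarith

/-- Concavity of `exp (-αf)` gives `exp (α(f w - f u)) ≤ 1 + αx`. Bernoulli's inequality with
exponent `2β/α ≤ 1` lowers `α` to `2β`, where `|2βx| ≤ 1/4`; the logarithm then yields the quadratic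
gain. -/
lemma expConcaveOn_sub_le {d : ℕ} {Ω : Set (Vec d)} {f : Vec d → ℝ} {α β D G : ℝ} (hα : 0 < α)
    (hD : 0 < D) (hG : 0 < G) (hβ : β = 1 / 2 * min (1 / (4 * G * D)) α)
    (hf : ExpConcaveOn Ω α f) {γ w u : Vec d} (h : HasGradientWithinAt f γ Ω w) (hw : w ∈ Ω)
    (hu : u ∈ Ω) (hγ : ‖γ‖ ≤ G) (hwu : ‖w - u‖ ≤ D) :
    f w - f u ≤ inner ℝ γ (w - u) - β / 2 * (inner ℝ γ (w - u)) ^ 2 := by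
  set x := inner ℝ γ (w - u) with hx
  have hxGD : |x| ≤ G * D := (abs_real_inner_le_norm _ _).trans
    (mul_le_mul hγ hwu (norm_nonneg _) hG.le)
  have hβ0 : 0 < β := by rw [hβ]; positivity
  have hβα : 2 * β ≤ α := by
    rw [hβ]; linarith [min_le_right (1 / (4 * G * D)) α]
  have hβGD : 2 * β * (G * D) ≤ 1 / 4 := by
    have : 2 * β ≤ 1 / (4 * G * D) := by
      rw [hβ]; linarith [min_le_left (1 / (4 * G * D)) α]
    rw [le_div_iff₀ (by positivity)] at this
    linarith
  have hexp : HasFDerivWithinAt (-fun v => Real.exp (-α * f v)) _ Ω w :=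
    ((h.hasFDerivWithinAt.const_mul (-α)).exp).neg
  have h1 := convexOn_add_fderiv_le hf.neg hexp hw hu
  simp only [Pi.neg_apply, _root_.neg_apply, _root_.smul_apply,
    InnerProductSpace.toDual_apply_apply, smul_eq_mul] at h1
  rw [← neg_sub w u, inner_neg_right, ← hx] at h1
  have h2 : Real.exp (α * (f w - f u)) ≤ 1 + α * x := by
    have e : Real.exp (-α * f u) = Real.exp (-α * f w) * Real.exp (α * (f w - f u)) := by
      rw [← Real.exp_add]; congr 1; ring
    rw [e] at h1
    have := Real.exp_pos (-α * f w)
    refine le_of_mul_le_mul_left ?_ this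
    linarith
  -- Bernoulli needs `1 + αx ≥ 0`, which is free since it dominates an exponential.
  have hs : -1 ≤ α * x := by linarith [Real.exp_pos (α * (f w - f u))]
  have h3 : Real.exp (2 * β * (f w - f u)) ≤ 1 + 2 * β * x := by
    have hp0 : 0 ≤ 2 * β / α := by positivity
    have := rpow_one_add_le_one_add_mul_self hs hp0 ((div_le_one hα).2 hβα)
    have h5 := Real.rpow_le_rpow (Real.exp_pos _).le h2 hp0
    rw [← Real.exp_mul] at h5
    have e : α * (f w - f u) * (2 * β / α) = 2 * β * (f w - f u) := by field_simp
    have e' : 2 * β / α * (α * x) = 2 * β * x := by field_simp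
    rw [e] at h5
    rw [e'] at this
    exact h5.trans this
  have hy : |2 * β * x| ≤ 1 / 4 := by
    rw [abs_mul, abs_of_pos (by positivity)]
    exact (mul_le_mul_of_nonneg_left hxGD (by positivity)).trans hβGD
  have h4 : 2 * β * (f w - f u) ≤ 2 * β * x - (2 * β * x) ^ 2 / 4 :=
    ((Real.le_log_iff_exp_le (by linarith [Real.exp_pos (2 * β * (f w - f u))])).2 h3).trans
      (log_one_add_le hy)
  refine le_of_mul_le_mul_left ?_ (by positivity : 0 < 2 * β)
  linarith

/-! ### Summation over a cover -/

lemma list_sum_sqrt_le {ι : Type*} (P : List ι) (x : ι → ℝ) (hx : ∀ i, 0 ≤ x i) :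
    (P.map fun i => √(x i)).sum ≤ √(P.length) * √((P.map x).sum) := by
  induction P with
  | nil => simp
  | cons a P ih =>
    have hs : 0 ≤ (P.map x).sum := List.sum_nonneg (by simp; intro i _; exact hx i)
    simp only [List.map_cons, List.sum_cons, List.length_cons, Nat.cast_add, Nat.cast_one]
    refine (add_le_add_right ih _).trans ?_
    rw [← Real.sqrt_mul (by positivity : (0 : ℝ) ≤ P.length + 1)]
    apply Real.le_sqrt_of_sq_le
    have h1 := Real.sq_sqrt (hx a)
    have h2 := Real.sq_sqrt hs
    have h3 := Real.sq_sqrt (Nat.cast_nonneg P.length : (0 : ℝ) ≤ P.length)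
    -- After squaring, the difference of the two sides is exactly this square.
    nlinarith [sq_nonneg (√(P.length : ℝ) * √(x a) - √((P.map x).sum))]

lemma IsCover.sum_le_of_sqrt {P : List (ℕ × ℕ)} {p q : ℕ} (hP : IsCover P p (q + 1)) {b : ℝ}
    (hb : (P.length : ℝ) ≤ b) {h v : ℕ → ℝ} (hv : ∀ t, 0 ≤ v t) {c e : ℝ} (hc : 0 ≤ c)
    (he : 0 ≤ e)
    (hI : ∀ I ∈ P, ∑ t ∈ Finset.Icc I.1 I.2, h t
      ≤ c + e * √(∑ t ∈ Finset.Icc I.1 I.2, v t)) :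
    ∑ t ∈ Finset.Icc p q, h t ≤ c * b + e * √b * √(∑ t ∈ Finset.Icc p q, v t) := by
  have hIco : Finset.Icc p q = Finset.Ico p (q + 1) := by
    ext t; simp only [Finset.mem_Ico, Finset.mem_Icc]; omega
  rw [hIco, ← hP.sum_eq, ← hP.sum_eq]
  refine (List.sum_le_sum hI).trans ?_
  rw [List.sum_map_add, List.sum_map_mul_left, List.map_const', List.sum_replicate, nsmul_eq_mul]
  have h1 := list_sum_sqrt_le P (fun I => ∑ t ∈ Finset.Icc I.1 I.2, v t)
    fun I => Finset.sum_nonneg fun t _ => hv t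
  have h2 := Real.sqrt_le_sqrt hb
  have h3 : e * (P.map fun I => √(∑ t ∈ Finset.Icc I.1 I.2, v t)).sum
      ≤ e * √b * √((P.map fun I => ∑ t ∈ Finset.Icc I.1 I.2, v t).sum) := by
    rw [mul_assoc]
    refine mul_le_mul_of_nonneg_left (h1.trans ?_) he
    gcongr
  nlinarith

/-- Unlike Cauchy–Schwarz, this keeps the sum of square roots itself, whose geometric decay avoids
the factor `√b`. -/
lemma IsCover.sum_le_of_length {P : List (ℕ × ℕ)} {p q : ℕ} (hP : IsCover P p (q + 1)) {b s : ℝ}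
    (hb : (P.length : ℝ) ≤ b) (hs : sqrtLength P ≤ s) {h : ℕ → ℝ} {c e : ℝ} (hc : 0 ≤ c)
    (he : 0 ≤ e)
    (hI : ∀ I ∈ P, ∑ t ∈ Finset.Icc I.1 I.2, h t ≤ c + e * √(intervalLength I : ℝ)) :
    ∑ t ∈ Finset.Icc p q, h t ≤ c * b + e * s := by
  have hIco : Finset.Icc p q = Finset.Ico p (q + 1) := by
    ext t; simp only [Finset.mem_Ico, Finset.mem_Icc]; omega
  rw [hIco, ← hP.sum_eq]
  refine (List.sum_le_sum hI).trans ?_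
  rw [List.sum_map_add, List.sum_map_mul_left, List.map_const', List.sum_replicate, nsmul_eq_mul]
  have := mul_le_mul_of_nonneg_left hs he
  have := mul_le_mul_of_nonneg_left hb hc
  rw [sqrtLength] at *
  linarith

/-! ### The factors of the bounds -/

section Factors

variable {p q : ℕ}

lemma log_two_le_log_length (hpq : p ≤ q) : Real.log 2 ≤ Real.log ((q : ℝ) - p + 2) := by
  have : (p : ℝ) ≤ q := by exact_mod_cast hpq
  exact Real.log_le_log (by norm_num) (by linarith)

lemma log_length_le (hp : 1 ≤ p) (hpq : p ≤ q) :
    Real.log ((q : ℝ) - p + 2) ≤ Real.log (q + 1) := by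
  have h1 : (p : ℝ) ≤ q := by exact_mod_cast hpq
  have h2 : (1 : ℝ) ≤ p := by exact_mod_cast hp
  exact Real.log_le_log (by linarith) (by linarith)

lemma logb_two_mul_nonneg (hq : 1 ≤ q) : 0 ≤ Real.logb 2 (2 * q) := by
  have h2 : (1 : ℝ) ≤ q := by exact_mod_cast hq
  exact Real.logb_nonneg (by norm_num) (by linarith)

lemma one_le_aHat (hp : 1 ≤ p) (hpq : p ≤ q) : 1 ≤ aHat p q := by
  have h1 := log_two_le_log_length hpq
  have h2 := logb_two_mul_nonneg (hp.trans hpq)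
  have h3 := Real.log_two_gt_d9
  unfold aHat
  linarith

lemma one_le_aFun (d : ℕ) (hp : 1 ≤ p) (hpq : p ≤ q) : 1 ≤ aFun d p q := by
  have h1 := log_two_le_log_length hpq
  have h2 := logb_two_mul_nonneg (hp.trans hpq)
  have h3 := Real.log_two_gt_d9
  have h4 : 0 ≤ 5 * (d : ℝ) * Real.log ((q : ℝ) - p + 2) := mul_nonneg (by positivity) (by linarith)
  unfold aFun
  linarith

lemma logb_two_mul_le (hq : 1 ≤ q) : 2 * Real.logb 2 (2 * q) ≤ 6 * Real.log (q + 1) := by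
  have h2 : (1 : ℝ) ≤ q := by exact_mod_cast hq
  have h3 := Real.log_two_gt_d9
  -- From `2q ≤ (q + 1)²`; the final constant is `4/log 2 < 6`.
  have h4 : Real.log (2 * q) ≤ 2 * Real.log (q + 1) := by
    have : Real.log ((q + 1 : ℝ) ^ 2) = 2 * Real.log (q + 1) := by rw [Real.log_pow]; norm_num
    rw [← this]
    exact Real.log_le_log (by linarith) (by nlinarith)
  have h5 : 0 ≤ Real.log ((q : ℝ) + 1) := Real.log_nonneg (by linarith)
  rw [Real.logb, ← mul_div_assoc, div_le_iff₀ (by linarith)]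
  nlinarith

lemma log_two_le_log_succ (hq : 1 ≤ q) : Real.log 2 ≤ Real.log (q + 1) := by
  have h2 : (1 : ℝ) ≤ q := by exact_mod_cast hq
  exact Real.log_le_log (by norm_num) (by linarith)

lemma aHat_le (hp : 1 ≤ p) (hpq : p ≤ q) : aHat p q ≤ 9 * Real.log (q + 1) := by
  have h1 := log_length_le hp hpq
  have h2 := logb_two_mul_le (hp.trans hpq)
  have h3 := log_two_le_log_succ (hp.trans hpq)
  have h4 := Real.log_two_gt_d9
  unfold aHat
  linarith

lemma aFun_le {d : ℕ} (hd : 1 ≤ d) (hp : 1 ≤ p) (hpq : p ≤ q) :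
    aFun d p q ≤ 19 * (d * Real.log (q + 1)) := by
  have hd' : (1 : ℝ) ≤ d := by exact_mod_cast hd
  have h1 := mul_le_mul_of_nonneg_left (log_length_le hp hpq) (by positivity : (0 : ℝ) ≤ 5 * d)
  have h2 := logb_two_mul_le (hp.trans hpq)
  have h3 := log_two_le_log_succ (hp.trans hpq)
  have h4 := Real.log_two_gt_d9
  unfold aFun
  nlinarith

lemma bFun_le (hpq : p ≤ q) : bFun p q ≤ 6 * Real.log ((q : ℝ) - p + 2) := by
  have h1 := log_two_le_log_length hpq
  have h3 := Real.log_two_gt_d9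
  have h2 := (Int.ceil_lt_add_one (Real.logb 2 ((q : ℝ) - p + 2))).le
  rw [Real.logb] at h2
  have h5 : 1 ≤ Real.log ((q : ℝ) - p + 2) / Real.log 2 := (one_le_div (by linarith)).2 h1
  have h6 : Real.log ((q : ℝ) - p + 2) / Real.log 2 ≤ 3 / 2 * Real.log ((q : ℝ) - p + 2) := by
    rw [div_le_iff₀ (by linarith)]
    nlinarith
  unfold bFun
  rw [Real.logb]
  linarith

lemma bFun_nonneg (hpq : p ≤ q) : 0 ≤ bFun p q := by
  have h1 : (p : ℝ) ≤ q := by exact_mod_cast hpq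
  have h2 : 0 ≤ Real.logb 2 ((q : ℝ) - p + 2) := Real.logb_nonneg (by norm_num) (by linarith)
  have h3 : (0 : ℝ) ≤ (⌈Real.logb 2 ((q : ℝ) - p + 2)⌉ : ℝ) := h2.trans (Int.le_ceil _)
  unfold bFun
  linarith

end Factors

/-! ### Linearized regret -/

section Regret

variable {d : ℕ} {Ω : Set (Vec d)} {D G : ℝ} {T : ℕ} {g : ℕ → Vec d → Vec d}
  {x₀ y₀ : ℕ × ℕ → ℝ → Vec d} {w : ℕ → Vec d} {p q : ℕ} {I : ℕ × ℕ} {u : Vec d}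

lemma cast_intervalLength_add_one_le (h1 : I.1 ≤ I.2) (hp : p ≤ I.1) (hq : I.2 ≤ q) :
    ((intervalLength I : ℝ) + 1) ≤ (q : ℝ) - p + 2 := by
  have : intervalLength I + 1 + p ≤ q + 2 := by unfold intervalLength; omega
  have h : ((intervalLength I : ℝ) + 1 + p) ≤ q + 2 := by exact_mod_cast this
  linarith

lemma card_Icc_eq_intervalLength (I : ℕ × ℕ) : (Finset.Icc I.1 I.2).card = intervalLength I := by
  rw [Nat.card_Icc, intervalLength]

lemma Admissible.abs_inner_le (h : Admissible Ω D G T g x₀ y₀) (hw : w = play Ω D G g x₀ y₀)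
    {t : ℕ} (ht1 : 1 ≤ t) (htT : t ≤ T) (hu : u ∈ Ω) :
    |inner ℝ (g t (w t)) (w t - u)| ≤ G * ‖w t - u‖ ∧ ‖w t - u‖ ≤ D := by
  have hwt : w t ∈ Ω := by rw [hw]; exact h.play_mem ht1
  refine ⟨(abs_real_inner_le_norm _ _).trans ?_, h.diam _ hwt _ hu⟩
  exact mul_le_mul_of_nonneg_right (h.grad t (Finset.mem_Icc.2 ⟨ht1, htT⟩) _ hwt) (norm_nonneg _)

/-- The expert of rate `η` cannot beat the learner by more than `2 log₂(2q)`, and it loses at most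
`5d log + 5` against `u`. The sum of these is `aFun`; tuning over `η` does the rest. -/
lemma Admissible.interval_sq_inner (h : Admissible Ω D G T g x₀ y₀)
    (hw : w = play Ω D G g x₀ y₀) (hp : 1 ≤ p) (hq : q ≤ T) (hI : I ∈ gcIntervals)
    (h1 : p ≤ I.1) (h2 : I.1 ≤ I.2) (h3 : I.2 ≤ q) (hu : u ∈ Ω) :
    ∑ t ∈ Finset.Icc I.1 I.2, inner ℝ (g t (w t)) (w t - u) ≤ 10 * D * G * aFun d p q
      + 3 * √(aFun d p q * ∑ t ∈ Finset.Icc I.1 I.2, (inner ℝ (g t (w t)) (w t - u)) ^ 2) := by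
  have hpq : p ≤ q := by omega
  refine tuned_bound (n := intervalLength I) h.D_pos h.G_pos (by unfold intervalLength; omega)
    (one_le_aFun d hp hpq) ?_ fun η hη => ?_
  · rw [← card_Icc_eq_intervalLength, ← nsmul_eq_mul]
    refine Finset.sum_le_card_nsmul _ _ _ fun t ht => ?_
    rw [Finset.mem_Icc] at ht
    obtain ⟨h4, h5⟩ := h.abs_inner_le hw (t := t) (by omega) (by omega) hu
    rw [sq_le_sq, abs_of_pos (mul_pos h.D_pos h.G_pos), mul_comm]
    exact h4.trans (mul_le_mul_of_nonneg_left h5 h.G_pos.le)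
  · have hs := smallRate_of_mem h.D_pos h.G_pos hη
    have h4 := (h.loss_ge hq h3 (by omega) hI (by omega) hη).1
    have h5 := h.ons_regret (by omega) h2 (by omega) hs hu
    have h6 : Real.log ((intervalLength I : ℝ) + 1) ≤ Real.log ((q : ℝ) - p + 2) :=
      Real.log_le_log (by positivity) (cast_intervalLength_add_one_le h2 h1 h3)
    have h7 := mul_le_mul_of_nonneg_left h6 (by positivity : (0 : ℝ) ≤ 5 * d)
    rw [← hw] at h5
    simp only [surrogate, Finset.sum_add_distrib, ← Finset.mul_sum] at h5
    have h8 : η * ∑ t ∈ Finset.Icc I.1 I.2, inner ℝ (g t (w t)) (w t - u)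
        ≤ aFun d p q
          + η ^ 2 * ∑ t ∈ Finset.Icc I.1 I.2, (inner ℝ (g t (w t)) (w t - u)) ^ 2 := by
      unfold aFun; linarith
    have h9 := hs.pos
    rw [div_add' _ _ _ h9.ne', le_div_iff₀ h9]
    linarith

lemma Admissible.interval_sq_norm (h : Admissible Ω D G T g x₀ y₀)
    (hw : w = play Ω D G g x₀ y₀) (hp : 1 ≤ p) (hq : q ≤ T) (hI : I ∈ gcIntervals)
    (h1 : p ≤ I.1) (h2 : I.1 ≤ I.2) (h3 : I.2 ≤ q) (hu : u ∈ Ω) :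
    ∑ t ∈ Finset.Icc I.1 I.2, inner ℝ (g t (w t)) (w t - u) ≤ 10 * D * G * aHat p q
      + 3 * √(aHat p q * (G ^ 2 * ∑ t ∈ Finset.Icc I.1 I.2, ‖w t - u‖ ^ 2)) := by
  have hpq : p ≤ q := by omega
  refine tuned_bound (n := intervalLength I) h.D_pos h.G_pos (by unfold intervalLength; omega)
    (one_le_aHat hp hpq) ?_ fun η hη => ?_
  · rw [← card_Icc_eq_intervalLength, ← nsmul_eq_mul, Finset.mul_sum]
    refine Finset.sum_le_card_nsmul _ _ _ fun t ht => ?_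
    rw [Finset.mem_Icc] at ht
    obtain ⟨h4, h5⟩ := h.abs_inner_le hw (t := t) (by omega) (by omega) hu
    rw [mul_pow, mul_comm]
    gcongr
  · have hs := smallRate_of_mem h.D_pos h.G_pos hη
    have h4 := (h.loss_ge hq h3 (by omega) hI (by omega) hη).2
    have h5 := h.aogd_regret (by omega) h2 (by omega) hs hu
    have h6 : Real.log ((intervalLength I : ℝ) + 1) ≤ Real.log ((q : ℝ) - p + 2) :=
      Real.log_le_log (by positivity) (cast_intervalLength_add_one_le h2 h1 h3)
    have h7 : ∑ t ∈ Finset.Icc I.1 I.2, surrogateHat η (g t (w t)) (w t) u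
        ≤ ∑ t ∈ Finset.Icc I.1 I.2, (-η * inner ℝ (g t (w t)) (w t - u)
          + η ^ 2 * (G ^ 2 * ‖w t - u‖ ^ 2)) := by
      refine Finset.sum_le_sum fun t ht => ?_
      rw [Finset.mem_Icc] at ht
      have hwt : w t ∈ Ω := by rw [hw]; exact h.play_mem (by omega)
      have hγ := h.grad t (Finset.mem_Icc.2 ⟨by omega, by omega⟩) _ hwt
      unfold surrogateHat
      rw [mul_assoc (η ^ 2)]
      gcongr
    rw [← hw] at h5
    simp only [Finset.sum_add_distrib, ← Finset.mul_sum] at h7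
    have h8 : η * ∑ t ∈ Finset.Icc I.1 I.2, inner ℝ (g t (w t)) (w t - u)
        ≤ aHat p q + η ^ 2 * (G ^ 2 * ∑ t ∈ Finset.Icc I.1 I.2, ‖w t - u‖ ^ 2) := by
      unfold aHat; linarith
    have h9 := hs.pos
    rw [div_add' _ _ _ h9.ne', le_div_iff₀ h9]
    linarith

lemma Admissible.sum_inner_le_sq_inner (h : Admissible Ω D G T g x₀ y₀)
    (hw : w = play Ω D G g x₀ y₀) (hp : 1 ≤ p) (hpq : p ≤ q) (hq : q ≤ T) (hu : u ∈ Ω) :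
    ∑ t ∈ Finset.Icc p q, inner ℝ (g t (w t)) (w t - u)
      ≤ 10 * D * G * aFun d p q * bFun p q + 3 * √(aFun d p q * bFun p q)
        * √(∑ t ∈ Finset.Icc p q, (inner ℝ (g t (w t)) (w t - u)) ^ 2) := by
  obtain ⟨P, hP, hl, -⟩ := exists_cover hp hpq
  have hD := h.D_pos
  have hG := h.G_pos
  have ha : 0 ≤ aFun d p q := by linarith [one_le_aFun d hp hpq]
  have := hP.sum_le_of_sqrt hl (h := fun t => inner ℝ (g t (w t)) (w t - u))
    (v := fun t => (inner ℝ (g t (w t)) (w t - u)) ^ 2) (fun t => sq_nonneg _)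
    (c := 10 * D * G * aFun d p q) (e := 3 * √(aFun d p q)) (by positivity) (by positivity)
    fun I hI => by
      obtain ⟨h1, h2, h3, h4⟩ := hP.mem I hI
      have := h.interval_sq_inner hw hp hq h1 h2 h3 (by omega) hu
      rwa [Real.sqrt_mul ha, ← mul_assoc] at this
  rwa [Real.sqrt_mul ha, ← mul_assoc 3]

lemma Admissible.sum_inner_le_sq_norm (h : Admissible Ω D G T g x₀ y₀)
    (hw : w = play Ω D G g x₀ y₀) (hp : 1 ≤ p) (hpq : p ≤ q) (hq : q ≤ T) (hu : u ∈ Ω) :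
    ∑ t ∈ Finset.Icc p q, inner ℝ (g t (w t)) (w t - u)
      ≤ 10 * D * G * aHat p q * bFun p q + 3 * G * √(aHat p q * bFun p q)
        * √(∑ t ∈ Finset.Icc p q, ‖w t - u‖ ^ 2) := by
  obtain ⟨P, hP, hl, -⟩ := exists_cover hp hpq
  have hD := h.D_pos
  have hG := h.G_pos
  have ha : 0 ≤ aHat p q := by linarith [one_le_aHat hp hpq]
  have := hP.sum_le_of_sqrt hl (h := fun t => inner ℝ (g t (w t)) (w t - u))
    (v := fun t => ‖w t - u‖ ^ 2) (fun t => sq_nonneg _)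
    (c := 10 * D * G * aHat p q) (e := 3 * G * √(aHat p q)) (by positivity) (by positivity)
    fun I hI => by
      obtain ⟨h1, h2, h3, h4⟩ := hP.mem I hI
      have := h.interval_sq_norm hw hp hq h1 h2 h3 (by omega) hu
      rw [Real.sqrt_mul ha, Real.sqrt_mul (sq_nonneg G), Real.sqrt_sq hG.le] at this
      linarith
  rwa [Real.sqrt_mul ha, ← mul_assoc (3 * G)]

lemma Admissible.interval_length (h : Admissible Ω D G T g x₀ y₀)
    (hw : w = play Ω D G g x₀ y₀) (hp : 1 ≤ p) (hq : q ≤ T) (hI : I ∈ gcIntervals)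
    (h1 : p ≤ I.1) (h2 : I.1 ≤ I.2) (h3 : I.2 ≤ q) (hu : u ∈ Ω) :
    ∑ t ∈ Finset.Icc I.1 I.2, inner ℝ (g t (w t)) (w t - u) ≤ 10 * D * G * aHat p q
      + 3 * D * G * √(aHat p q) * √(intervalLength I : ℝ) := by
  have hD := h.D_pos
  have hG := h.G_pos
  have ha : 0 ≤ aHat p q := by linarith [one_le_aHat hp (by omega : p ≤ q)]
  refine (h.interval_sq_norm hw hp hq hI h1 h2 h3 hu).trans ?_
  have h4 : ∑ t ∈ Finset.Icc I.1 I.2, ‖w t - u‖ ^ 2 ≤ intervalLength I * D ^ 2 := by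
    rw [← card_Icc_eq_intervalLength, ← nsmul_eq_mul]
    refine Finset.sum_le_card_nsmul _ _ _ fun t ht => ?_
    rw [Finset.mem_Icc] at ht
    exact pow_le_pow_left₀ (norm_nonneg _)
      (h.abs_inner_le hw (t := t) (by omega) (by omega) hu).2 2
  have h5 : √(aHat p q * (G ^ 2 * ∑ t ∈ Finset.Icc I.1 I.2, ‖w t - u‖ ^ 2))
      ≤ √(aHat p q) * (G * (√(intervalLength I : ℝ) * D)) := by
    rw [Real.sqrt_mul ha, Real.sqrt_mul (sq_nonneg G), Real.sqrt_sq hG.le]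
    have := Real.sqrt_le_sqrt h4
    rw [Real.sqrt_mul (by positivity), Real.sqrt_sq hD.le] at this
    gcongr
  linarith

lemma Admissible.sum_inner_le_length (h : Admissible Ω D G T g x₀ y₀)
    (hw : w = play Ω D G g x₀ y₀) (hp : 1 ≤ p) (hpq : p ≤ q) (hq : q ≤ T) (hu : u ∈ Ω) :
    ∑ t ∈ Finset.Icc p q, inner ℝ (g t (w t)) (w t - u)
      ≤ 10 * D * G * aHat p q * bFun p q
        + 21 * D * G * √(aHat p q * ((q : ℝ) - p + 1)) := by
  obtain ⟨P, hP, hl, hs⟩ := exists_cover hp hpq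
  have hD := h.D_pos
  have hG := h.G_pos
  have ha : 0 ≤ aHat p q := by linarith [one_le_aHat hp hpq]
  have := hP.sum_le_of_length hl hs (h := fun t => inner ℝ (g t (w t)) (w t - u))
    (c := 10 * D * G * aHat p q) (e := 3 * D * G * √(aHat p q)) (by positivity) (by positivity)
    fun I hI => by
      obtain ⟨h1, h2, h3, h4⟩ := hP.mem I hI
      exact h.interval_length hw hp hq h1 h2 h3 (by omega) hu
  rw [Real.sqrt_mul ha]
  linarith

/-- A worst-case bound without a lower-order term: on intervals that are shorter than `aHat p q` the
trivial bound on the regret is used. -/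
lemma Admissible.sum_inner_le_sqrt (h : Admissible Ω D G T g x₀ y₀)
    (hw : w = play Ω D G g x₀ y₀) (hp : 1 ≤ p) (hpq : p ≤ q) (hq : q ≤ T) (hu : u ∈ Ω) :
    ∑ t ∈ Finset.Icc p q, inner ℝ (g t (w t)) (w t - u)
      ≤ 91 * (D * G) * √(aHat p q * ((q : ℝ) - p + 1)) := by
  obtain ⟨P, hP, hl, hs⟩ := exists_cover hp hpq
  have hD := h.D_pos
  have hG := h.G_pos
  have ha : 0 ≤ aHat p q := by linarith [one_le_aHat hp hpq]
  have hDG : 0 < D * G := mul_pos hD hG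
  have := hP.sum_le_of_length hl hs (h := fun t => inner ℝ (g t (w t)) (w t - u))
    -- On long pieces `aHat ≤ √(aHat · length)`, so `10 + 3 = 13`; short pieces satisfy `length ≤
    -- √(aHat · length)`. The cover contributes `7`, whence `91`.
    (c := 0) (e := 13 * (D * G) * √(aHat p q)) le_rfl (by positivity)
    fun I hI => by
      obtain ⟨h1, h2, h3, h4⟩ := hP.mem I hI
      have e1 := Real.mul_self_sqrt ha
      have e2 := Real.mul_self_sqrt (Nat.cast_nonneg (intervalLength I) : (0 : ℝ) ≤ _)
      rcases le_total (intervalLength I : ℝ) (aHat p q) with h5 | h5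
      · have h6 : ∑ t ∈ Finset.Icc I.1 I.2, inner ℝ (g t (w t)) (w t - u)
            ≤ intervalLength I * (D * G) := by
          rw [← card_Icc_eq_intervalLength, ← nsmul_eq_mul]
          refine Finset.sum_le_card_nsmul _ _ _ fun t ht => ?_
          rw [Finset.mem_Icc] at ht
          obtain ⟨h4, h5⟩ := h.abs_inner_le hw (t := t) (by omega) (by omega) hu
          rw [mul_comm D]
          exact (le_abs_self _).trans (h4.trans (mul_le_mul_of_nonneg_left h5 hG.le))
        have h7 : (intervalLength I : ℝ) ≤ √(aHat p q) * √(intervalLength I : ℝ) := by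
          nth_rw 1 [← e2]
          exact mul_le_mul_of_nonneg_right (Real.sqrt_le_sqrt h5) (Real.sqrt_nonneg _)
        have h8 := mul_le_mul_of_nonneg_right h7 hDG.le
        have h9 : 0 ≤ √(aHat p q) * √(intervalLength I : ℝ) * (D * G) := by positivity
        linarith
      · have h6 := h.interval_length hw hp hq h1 h2 h3 (by omega) hu
        have h7 : aHat p q ≤ √(aHat p q) * √(intervalLength I : ℝ) := by
          nth_rw 1 [← e1]
          exact mul_le_mul_of_nonneg_left (Real.sqrt_le_sqrt h5) (Real.sqrt_nonneg _)
        have h8 := mul_le_mul_of_nonneg_right h7 hDG.le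
        linarith
  rw [Real.sqrt_mul ha]
  linarith

/-! ### Regret of exp-concave, strongly convex and convex losses -/

variable {f : ℕ → Vec d → ℝ}

/-- Weighted AM–GM: the regret bound's factor `√V` is traded for `(l/2) V`, which the curvature of
the losses cancels. -/
lemma mul_mul_le_sq_div {l : ℝ} (hl : 0 < l) (e s v : ℝ) :
    e * s * v ≤ e ^ 2 / (2 * l) * s ^ 2 + l / 2 * v ^ 2 := by
  have h : e ^ 2 / (2 * l) * s ^ 2 + l / 2 * v ^ 2 - e * s * v = (e * s - l * v) ^ 2 / (2 * l) := by
    field_simp; ring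
  have : 0 ≤ (e * s - l * v) ^ 2 / (2 * l) := by positivity
  linarith

lemma Admissible.regret_expConcave (h : Admissible Ω D G T g x₀ y₀)
    (hf : ∀ t ∈ Finset.Icc 1 T, ∀ x ∈ Ω, HasGradientWithinAt (f t) (g t x) Ω x)
    (hw : w = play Ω D G g x₀ y₀) (hp : 1 ≤ p) (hpq : p ≤ q) (hq : q ≤ T) (hu : u ∈ Ω)
    {α β : ℝ} (hα : 0 < α) (hβ : β = 1 / 2 * min (1 / (4 * G * D)) α)
    (hexp : ∀ t ∈ Finset.Icc p q, ExpConcaveOn Ω α (f t)) :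
    ∑ t ∈ Finset.Icc p q, f t (w t) - ∑ t ∈ Finset.Icc p q, f t u
      ≤ (10 * D * G + 9 / (2 * β)) * aFun d p q * bFun p q := by
  have hD := h.D_pos
  have hG := h.G_pos
  have hβ0 : 0 < β := by rw [hβ]; positivity
  have h1 := h.sum_inner_le_sq_inner hw hp hpq hq hu
  have h2 : ∑ t ∈ Finset.Icc p q, (f t (w t) - f t u) ≤ ∑ t ∈ Finset.Icc p q,
      (inner ℝ (g t (w t)) (w t - u) - β / 2 * (inner ℝ (g t (w t)) (w t - u)) ^ 2) := by
    refine Finset.sum_le_sum fun t ht => ?_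
    have ht' := Finset.mem_Icc.1 ht
    have htT : t ∈ Finset.Icc 1 T := Finset.mem_Icc.2 ⟨by omega, by omega⟩
    have hwt : w t ∈ Ω := by rw [hw]; exact h.play_mem (by omega)
    exact expConcaveOn_sub_le hα hD hG hβ (hexp t ht) (hf t htT _ hwt) hwt hu
      (h.grad t htT _ hwt) (h.diam _ hwt _ hu)
  rw [Finset.sum_sub_distrib, Finset.sum_sub_distrib, ← Finset.mul_sum] at h2
  have h3 := mul_mul_le_sq_div hβ0 3 (√(aFun d p q * bFun p q))
    (√(∑ t ∈ Finset.Icc p q, (inner ℝ (g t (w t)) (w t - u)) ^ 2))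
  rw [Real.sq_sqrt (mul_nonneg (by linarith [one_le_aFun d hp hpq]) (bFun_nonneg hpq)),
    Real.sq_sqrt (Finset.sum_nonneg fun t _ => sq_nonneg _)] at h3
  norm_num at h3 ⊢
  linarith

lemma Admissible.regret_stronglyConvex (h : Admissible Ω D G T g x₀ y₀)
    (hw : w = play Ω D G g x₀ y₀) (hp : 1 ≤ p) (hpq : p ≤ q) (hq : q ≤ T) (hu : u ∈ Ω)
    {lam : ℝ} (hlam : 0 < lam)
    (hsc : ∀ t ∈ Finset.Icc p q, StronglyConvexOn Ω lam (f t) (g t)) :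
    ∑ t ∈ Finset.Icc p q, f t (w t) - ∑ t ∈ Finset.Icc p q, f t u
      ≤ (10 * D * G + 9 * G ^ 2 / (2 * lam)) * aHat p q * bFun p q := by
  have h1 := h.sum_inner_le_sq_norm hw hp hpq hq hu
  have h2 : ∑ t ∈ Finset.Icc p q, (f t (w t) - f t u) ≤ ∑ t ∈ Finset.Icc p q,
      (inner ℝ (g t (w t)) (w t - u) - lam / 2 * ‖w t - u‖ ^ 2) := by
    refine Finset.sum_le_sum fun t ht => ?_
    have ht' := Finset.mem_Icc.1 ht
    have hwt : w t ∈ Ω := by rw [hw]; exact h.play_mem (by omega)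
    have := hsc t ht _ hwt _ hu
    rw [← neg_sub (w t) u, inner_neg_right, norm_neg] at this
    linarith
  rw [Finset.sum_sub_distrib, Finset.sum_sub_distrib, ← Finset.mul_sum] at h2
  have h3 := mul_mul_le_sq_div hlam (3 * G) (√(aHat p q * bFun p q))
    (√(∑ t ∈ Finset.Icc p q, ‖w t - u‖ ^ 2))
  rw [Real.sq_sqrt (mul_nonneg (by linarith [one_le_aHat hp hpq]) (bFun_nonneg hpq)),
    Real.sq_sqrt (Finset.sum_nonneg fun t _ => sq_nonneg _), mul_pow 3 G] at h3
  norm_num at h3 ⊢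
  linarith

lemma Admissible.regret_convex (h : Admissible Ω D G T g x₀ y₀)
    (hf : ∀ t ∈ Finset.Icc 1 T, ∀ x ∈ Ω, HasGradientWithinAt (f t) (g t x) Ω x)
    (hw : w = play Ω D G g x₀ y₀) (hp : 1 ≤ p) (hpq : p ≤ q) (hq : q ≤ T) (hu : u ∈ Ω)
    (hcv : ∀ t ∈ Finset.Icc 1 T, ConvexOn ℝ Ω (f t)) :
    ∑ t ∈ Finset.Icc p q, f t (w t) - ∑ t ∈ Finset.Icc p q, f t u
      ≤ 91 * (D * G) * √(aHat p q * ((q : ℝ) - p + 1)) := by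
  refine le_trans ?_ (h.sum_inner_le_sqrt hw hp hpq hq hu)
  rw [← Finset.sum_sub_distrib]
  refine Finset.sum_le_sum fun t ht => ?_
  have ht' := Finset.mem_Icc.1 ht
  have htT : t ∈ Finset.Icc 1 T := Finset.mem_Icc.2 ⟨by omega, by omega⟩
  have hwt : w t ∈ Ω := by rw [hw]; exact h.play_mem (by omega)
  exact convexOn_sub_le_inner (hcv t htT) (hf t htT _ hwt) hwt hu

lemma expConcave_factor_le {α β : ℝ} (hD : 0 < D) (hG : 0 < G) (hα : 0 < α)
    (hβ : β = 1 / 2 * min (1 / (4 * G * D)) α) (hd : 1 ≤ d) (hp : 1 ≤ p) (hpq : p ≤ q) :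
    (10 * D * G + 9 / (2 * β)) * aFun d p q * bFun p q
      ≤ 6000 * (1 + D * G * α) * (d * Real.log (q + 1) * Real.log ((q : ℝ) - p + 2) / α) := by
  have hβ0 : 0 < β := by rw [hβ]; positivity
  have hDG := mul_pos hD hG
  have h1 : 9 / (2 * β) ≤ 36 * (D * G) + 9 / α := by
    rcases min_cases (1 / (4 * G * D)) α with ⟨h1, -⟩ | ⟨h1, -⟩
    · rw [hβ, h1]
      have : 9 / (2 * (1 / 2 * (1 / (4 * G * D)))) = 36 * (D * G) := by field_simp; norm_num
      rw [this]
      have : 0 < 9 / α := by positivity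
      linarith
    · rw [hβ, h1]
      have : 9 / (2 * (1 / 2 * α)) = 9 / α := by congr 1; ring
      rw [this]
      linarith
  -- Here `46 = 10 + 36`, and below `46 · 19 · 6 = 5244`; rounded up, this determines the absolute
  -- constant.
  have h2 : 10 * D * G + 9 / (2 * β) ≤ 46 * ((1 + D * G * α) / α) := by
    have : 46 * ((1 + D * G * α) / α) = 46 / α + 46 * (D * G) := by field_simp
    rw [this]
    have : 9 / α ≤ 46 / α := by gcongr; norm_num
    linarith
  have h3 := aFun_le hd hp hpq
  have h4 := bFun_le hpq
  have hM : 0 ≤ Real.log ((q : ℝ) - p + 2) :=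
    (Real.log_nonneg (by norm_num)).trans (log_two_le_log_length hpq)
  have hL := hM.trans (log_length_le hp hpq)
  calc _ ≤ 46 * ((1 + D * G * α) / α) * (19 * (d * Real.log (q + 1)))
        * (6 * Real.log ((q : ℝ) - p + 2)) := by
        have := one_le_aFun d hp hpq
        have := bFun_nonneg hpq
        gcongr
    _ = 5244 * ((1 + D * G * α) * (d * Real.log (q + 1) * Real.log ((q : ℝ) - p + 2) / α)) := by
        field_simp; ring
    _ ≤ _ := by
        rw [mul_assoc 6000]
        have : 0 ≤ (1 + D * G * α) * (d * Real.log (q + 1) * Real.log ((q : ℝ) - p + 2) / α) := by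
          positivity
        linarith

lemma stronglyConvex_factor_le {lam : ℝ} (hD : 0 < D) (hG : 0 < G) (hlam : 0 < lam)
    (hp : 1 ≤ p) (hpq : p ≤ q) :
    (10 * D * G + 9 * G ^ 2 / (2 * lam)) * aHat p q * bFun p q
      ≤ 6000 * (G ^ 2 + D * G * lam)
        * (Real.log (q + 1) * Real.log ((q : ℝ) - p + 2) / lam) := by
  have h2 : 10 * D * G + 9 * G ^ 2 / (2 * lam) ≤ 10 * ((G ^ 2 + D * G * lam) / lam) := by
    have e1 : 10 * ((G ^ 2 + D * G * lam) / lam) = 10 * (G ^ 2 / lam) + 10 * D * G := by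
      field_simp
    have e2 : 9 * G ^ 2 / (2 * lam) = 9 / 2 * (G ^ 2 / lam) := by field_simp
    have : 0 ≤ G ^ 2 / lam := by positivity
    rw [e1, e2]
    linarith
  have h3 := aHat_le hp hpq
  have h4 := bFun_le hpq
  have hM : 0 ≤ Real.log ((q : ℝ) - p + 2) :=
    (Real.log_nonneg (by norm_num)).trans (log_two_le_log_length hpq)
  have hL := hM.trans (log_length_le hp hpq)
  calc _ ≤ 10 * ((G ^ 2 + D * G * lam) / lam) * (9 * Real.log (q + 1))
        * (6 * Real.log ((q : ℝ) - p + 2)) := by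
        have := one_le_aHat hp hpq
        have := bFun_nonneg hpq
        gcongr
    _ = 540 * ((G ^ 2 + D * G * lam)
          * (Real.log (q + 1) * Real.log ((q : ℝ) - p + 2) / lam)) := by
        field_simp; ring
    _ ≤ _ := by
        rw [mul_assoc 6000]
        have : 0 ≤ (G ^ 2 + D * G * lam)
          * (Real.log (q + 1) * Real.log ((q : ℝ) - p + 2) / lam) := by positivity
        linarith

lemma Admissible.regret_expConcave_rate (h : Admissible Ω D G T g x₀ y₀)
    (hf : ∀ t ∈ Finset.Icc 1 T, ∀ x ∈ Ω, HasGradientWithinAt (f t) (g t x) Ω x)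
    (hw : w = play Ω D G g x₀ y₀) (hp : 1 ≤ p) (hpq : p ≤ q) (hq : q ≤ T) (hu : u ∈ Ω)
    {α : ℝ} (hα : 0 < α) (hexp : ∀ t ∈ Finset.Icc p q, ExpConcaveOn Ω α (f t)) :
    ∑ t ∈ Finset.Icc p q, f t (w t) - ∑ t ∈ Finset.Icc p q, f t u
      ≤ 6000 * (1 + D * G * α) * (d * Real.log (q + 1) * Real.log ((q : ℝ) - p + 2) / α) := by
  rcases Nat.eq_zero_or_pos d with rfl | hd
  -- In dimension zero the right side vanishes although `aFun` does not, so the factor estimate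
  -- fails; but the space is a single point.
  · have : ∀ t, w t = u := fun t => Subsingleton.elim _ _
    simp [this]
  · exact (h.regret_expConcave hf hw hp hpq hq hu hα rfl hexp).trans
      (expConcave_factor_le h.D_pos h.G_pos hα rfl hd hp hpq)

lemma saRegret_le {τ : ℕ} (hn : Ω.Nonempty) (hτ : 1 ≤ τ) (hτT : τ ≤ T) {B : ℝ}
    (hB : ∀ p q : ℕ, 1 ≤ p → p ≤ q → q ≤ T → (q : ℝ) - p + 1 = τ → ∀ u ∈ Ω,
      ∑ t ∈ Finset.Icc p q, f t (w t) - ∑ t ∈ Finset.Icc p q, f t u ≤ B) :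
    saRegret Ω f w T τ ≤ B := by
  refine csSup_le (Set.Nonempty.image _ ⟨1, le_rfl, by omega⟩) ?_
  rintro _ ⟨p, ⟨hp1, hp2⟩, rfl⟩
  have hlen : ((p + τ - 1 : ℕ) : ℝ) - p + 1 = τ := by
    rw [Nat.cast_sub (by omega)]; push_cast; ring
  have hle : ∑ t ∈ Finset.Icc p (p + τ - 1), f t (w t) - B
      ≤ sInf ((fun u => ∑ t ∈ Finset.Icc p (p + τ - 1), f t u) '' Ω) := by
    refine le_csInf (hn.image _) ?_
    rintro _ ⟨u, hu, rfl⟩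
    have := hB p (p + τ - 1) hp1 (by omega) hp2 hlen u hu
    simp only
    linarith
  simp only [staticRegret]
  linarith

lemma log_add_one_mono (hq : q ≤ T) : Real.log ((q : ℝ) + 1) ≤ Real.log (T + 1) := by
  have : (q : ℝ) ≤ T := by exact_mod_cast hq
  exact Real.log_le_log (by positivity) (by linarith)

end Regret

end UMA

/-! ### Assembly of the bounds -/

theorem theorem2 :
    ∃ C : ℝ, 0 < C ∧
    ∀ (d : ℕ) (Ω : Set (UMA.Vec d)) (D G : ℝ) (T : ℕ)
      (f : ℕ → UMA.Vec d → ℝ) (g : ℕ → UMA.Vec d → UMA.Vec d)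
      (x₀ y₀ : ℕ × ℕ → ℝ → UMA.Vec d),
      Ω.Nonempty → IsClosed Ω → Convex ℝ Ω → 0 < D → 0 < G →
      (∀ x ∈ Ω, ∀ y ∈ Ω, ‖x - y‖ ≤ D) →
      (∀ t ∈ Finset.Icc 1 T, ∀ x ∈ Ω, HasGradientWithinAt (f t) (g t x) Ω x) →
      (∀ t ∈ Finset.Icc 1 T, ∀ x ∈ Ω, ‖g t x‖ ≤ G) →
      (∀ I η, x₀ I η ∈ Ω) → (∀ I η, y₀ I η ∈ Ω) →
      ∀ w : ℕ → UMA.Vec d, w = UMA.play Ω D G g x₀ y₀ →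
      -- bounds on every interval `[p, q]`
      (∀ p q : ℕ, 1 ≤ p → p ≤ q → q ≤ T → ∀ u ∈ Ω,
        -- second-order bound in terms of the squared inner products
        (∑ t ∈ Finset.Icc p q, inner ℝ (g t (w t)) (w t - u)
          ≤ 10 * D * G * UMA.aFun d p q * UMA.bFun p q
            + 3 * √(UMA.aFun d p q * UMA.bFun p q)
              * √(∑ t ∈ Finset.Icc p q, (inner ℝ (g t (w t)) (w t - u)) ^ 2)) ∧
        -- exp-concave losses
        (∀ α β : ℝ, 0 < α → β = 1 / 2 * min (1 / (4 * G * D)) α →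
          (∀ t ∈ Finset.Icc p q, UMA.ExpConcaveOn Ω α (f t)) →
          (∑ t ∈ Finset.Icc p q, f t (w t) - ∑ t ∈ Finset.Icc p q, f t u
            ≤ (10 * D * G + 9 / (2 * β)) * UMA.aFun d p q * UMA.bFun p q) ∧
          (∑ t ∈ Finset.Icc p q, f t (w t) - ∑ t ∈ Finset.Icc p q, f t u
            ≤ C * (1 + D * G * α)
                * (d * Real.log (q + 1) * Real.log ((q : ℝ) - p + 2) / α))) ∧
        -- second-order bound in terms of the squared distances
        (∑ t ∈ Finset.Icc p q, inner ℝ (g t (w t)) (w t - u)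
          ≤ 10 * D * G * UMA.aHat p q * UMA.bFun p q
            + 3 * G * √(UMA.aHat p q * UMA.bFun p q)
              * √(∑ t ∈ Finset.Icc p q, ‖w t - u‖ ^ 2)) ∧
        -- worst-case bound
        (∑ t ∈ Finset.Icc p q, inner ℝ (g t (w t)) (w t - u)
          ≤ 10 * D * G * UMA.aHat p q * UMA.bFun p q
            + 21 * D * G * √(UMA.aHat p q * ((q : ℝ) - p + 1))) ∧
        -- strongly convex losses
        (∀ lam : ℝ, 0 < lam →
          (∀ t ∈ Finset.Icc p q, UMA.StronglyConvexOn Ω lam (f t) (g t)) →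
          (∑ t ∈ Finset.Icc p q, f t (w t) - ∑ t ∈ Finset.Icc p q, f t u
            ≤ (10 * D * G + 9 * G ^ 2 / (2 * lam)) * UMA.aHat p q * UMA.bFun p q) ∧
          (∑ t ∈ Finset.Icc p q, f t (w t) - ∑ t ∈ Finset.Icc p q, f t u
            ≤ C * (G ^ 2 + D * G * lam)
                * (Real.log (q + 1) * Real.log ((q : ℝ) - p + 2) / lam)))) ∧
      -- strongly adaptive regret
      (∀ τ : ℕ, 1 ≤ τ → τ ≤ T →
        -- convex losses
        ((∀ t ∈ Finset.Icc 1 T, ConvexOn ℝ Ω (f t)) →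
          UMA.saRegret Ω f w T τ ≤ C * (D * G) * √(τ * Real.log (T + 1))) ∧
        -- exp-concave losses
        (∀ α : ℝ, 0 < α → (∀ t ∈ Finset.Icc 1 T, UMA.ExpConcaveOn Ω α (f t)) →
          UMA.saRegret Ω f w T τ
            ≤ C * (1 + D * G * α)
                * (d / α * Real.log (τ + 1) * Real.log (T + 1))) ∧
        -- strongly convex losses
        (∀ lam : ℝ, 0 < lam →
          (∀ t ∈ Finset.Icc 1 T, UMA.StronglyConvexOn Ω lam (f t) (g t)) →
          UMA.saRegret Ω f w T τ
            ≤ C * (G ^ 2 + D * G * lam)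
                * (1 / lam * Real.log (τ + 1) * Real.log (T + 1)))) := by
  refine ⟨6000, by norm_num, ?_⟩
  intro d Ω D G T f g x₀ y₀ hn hcl hcv hD hG hdiam hgrad hbd hx hy w hw
  have hcomp : IsCompact Ω := by
    obtain ⟨z, hz⟩ := hn
    refine (isCompact_closedBall z D).of_isClosed_subset hcl fun x hx => ?_
    rw [Metric.mem_closedBall, dist_eq_norm]
    exact hdiam x hx z hz
  have h : UMA.Admissible Ω D G T g x₀ y₀ := ⟨hcomp, hn, hcv, hD, hG, hdiam, hbd, hx, hy⟩
  refine ⟨fun p q hp hpq hq u hu => ⟨h.sum_inner_le_sq_inner hw hp hpq hq hu, ?_,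
    h.sum_inner_le_sq_norm hw hp hpq hq hu, h.sum_inner_le_length hw hp hpq hq hu, ?_⟩,
    fun τ hτ hτT => ⟨fun hc => ?_, fun α hα hexp => ?_, fun lam hlam hsc => ?_⟩⟩
  · intro α β hα hβ hexp
    exact ⟨h.regret_expConcave hgrad hw hp hpq hq hu hα hβ hexp,
      h.regret_expConcave_rate hgrad hw hp hpq hq hu hα hexp⟩
  · intro lam hlam hsc
    have h1 := h.regret_stronglyConvex hw hp hpq hq hu hlam hsc
    exact ⟨h1, h1.trans (UMA.stronglyConvex_factor_le hD hG hlam hp hpq)⟩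
  · refine UMA.saRegret_le hn hτ hτT fun p q hp hpq hq hlen u hu => ?_
    refine (h.regret_convex hgrad hw hp hpq hq hu hc).trans ?_
    have h1 := (UMA.aHat_le hp hpq).trans
      (mul_le_mul_of_nonneg_left (UMA.log_add_one_mono hq) (by norm_num : (0 : ℝ) ≤ 9))
    -- `aHat ≤ 9 log (T + 1)` gives the factor `3`, and `91 · 3 = 273` is below the common constant.
    have h2 : √(UMA.aHat p q * ((q : ℝ) - p + 1)) ≤ 3 * √(τ * Real.log (T + 1)) := by
      rw [hlen]
      refine Real.sqrt_le_iff.2 ⟨by positivity, ?_⟩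
      have h3 : 0 ≤ Real.log ((T : ℝ) + 1) := Real.log_nonneg (by simp)
      rw [mul_pow, Real.sq_sqrt (by positivity)]
      have := mul_le_mul_of_nonneg_right h1 (by positivity : (0 : ℝ) ≤ τ)
      linarith
    have h4 := mul_le_mul_of_nonneg_left h2 (by positivity : 0 ≤ 91 * (D * G))
    have h5 : 0 ≤ D * G * √(τ * Real.log (T + 1)) := by positivity
    linarith
  · refine UMA.saRegret_le hn hτ hτT fun p q hp hpq hq hlen u hu => ?_
    refine (h.regret_expConcave_rate hgrad hw hp hpq hq hu hα fun t ht => hexp t ?_).trans ?_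
    · rw [Finset.mem_Icc] at ht ⊢; omega
    · have e : (q : ℝ) - p + 2 = τ + 1 := by linarith
      have h1 := UMA.log_add_one_mono hq
      have h2 : 0 ≤ Real.log ((τ : ℝ) + 1) := Real.log_nonneg (by simp)
      rw [e]
      calc _ ≤ 6000 * (1 + D * G * α) * (d * Real.log (T + 1) * Real.log (τ + 1) / α) := by gcongr
        _ = _ := by ring
  · refine UMA.saRegret_le hn hτ hτT fun p q hp hpq hq hlen u hu => ?_
    refine ((h.regret_stronglyConvex hw hp hpq hq hu hlam fun t ht => hsc t ?_).trans
      (UMA.stronglyConvex_factor_le hD hG hlam hp hpq)).trans ?_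
    · rw [Finset.mem_Icc] at ht ⊢; omega
    · have e : (q : ℝ) - p + 2 = τ + 1 := by linarith
      have h1 := UMA.log_add_one_mono hq
      have h2 : 0 ≤ Real.log ((τ : ℝ) + 1) := Real.log_nonneg (by simp)
      rw [e]
      calc _ ≤ 6000 * (G ^ 2 + D * G * lam) * (Real.log (T + 1) * Real.log (τ + 1) / lam) := by
            gcongr
        _ = _ := by ring
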